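/- \textbf{Conventions.} Let $W_n$ be one of the groups $S_n$ (type A), $B_n=\mathbb Z_2\wr S_n$ (type B/C), $D_n\le B_n$ (type D, an even number of sign changes), acting on $\mathbf n=\{\pm1,\dots,\pm n\}$ by signed permutations ($\mathbf 0=\emptyset$). The category $\mathrm{FI}_W$ has objects $\mathbf n$, $n\ge 0$; its morphisms are the injections $\phi:\mathbf m\to\mathbf n$ with $\phi(-t)=-\phi(t)$, which in type A must preserve signs, and in type D must, if $m=n$, send an even number of positive elements to negative ones; so $\mathrm{Aut}(\mathbf n)=W_n$. In types A and B/C, $\mathrm{FI}_W\#$ has objects $\mathbf n\cup\{0\}$, and its morphisms are the maps $\phi$ with $\phi(0)=0$ and $\phi(-t)=-\phi(t)$ that are injective away from $\phi^{-1}(0)$ (and, in type A, preserve the signs of the elements not sent to $0$); $\mathrm{FI}_W\subset \mathrm{FI}_W\#$ by extending maps by $0\mapsto 0$. An $\mathrm{FI}_W$-module (resp. $\mathrm{FI}_W\#$-module) over a field $k$ is a functor $V$ to $k$-vector spaces; $V_n:=V(\mathbf n)$, and the structure map $V_n\to V_{n+1}$ is induced by the standard inclusion $\mathbf n\subset\mathbf{n+1}$.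 $V$ is generated in stage $d$ if for every $m\ge d$ the images of $V_d$ under all $\mathrm{FI}_W$-morphisms $\mathbf d\to\mathbf m$ span $V_m$; it is finitely generated if for some $n$ it is generated in stage $n$ and $\dim V_n<\infty$ (for $\mathrm{FI}_W\#$-modules: if the underlying $\mathrm{FI}_W$-module is). Let $\operatorname{char}k=0$. For a partition $\lambda$ (type A), or a double partition $\lambda=(\lambda^+,\lambda^-)$ (other types; put $\lambda^+=\lambda$ in type A), and $n\ge|\lambda|+\lambda^+_1$, let $V(\lambda)_n$ be the irreducible representation of $S_n$ (type A) or $B_n$ (type B/C) indexed by $(n-|\lambda|,\lambda)$, respectively $((n-|\lambda|,\lambda^+),\lambda^-)$, and in type D the restriction of the latter to $D_n$; here $(n)$, respectively $((n),\emptyset)$, indexes the trivial representation and $(\emptyset,(n))$ the product of the signs. $V$ is representation stable if for all large $n$ the map $V_n\to V_{n+1}$ is injective, its image generates $V_{n+1}$ as a $k[W_{n+1}]$-module, and $V_n\cong\bigoplus_\lambda c_{\lambda,n}V(\lambda)_n$, where each $c_{\lambda,n}$ is eventually independent of $n$. It has stable range $n\ge N$ (with multiplicities $c_{\lambda,n}$)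 if it is representation stable, $V_n\cong\bigoplus_\lambda c_{\lambda,n}V(\lambda)_n$ for all $n\ge N$, and for every $\lambda$ the number $c_{\lambda,n}$ is the same for all $n\ge N$ for which $V(\lambda)_n$ is defined. For a finite group $H$ and a $k[H]$-module $U$ write $\overline u=\frac1{|H|}\sum_{h\in H}h\cdot u\in U^H$. \textbf{Proposition.} (1) Let $j:H_1\to H_2$ be a homomorphism of finite groups and $\phi:V_1\to V_2$ a $j$-equivariant linear map between a $\mathbb Q[H_1]$-module $V_1$ and a $\mathbb Q[H_2]$-module $V_2$. If $\phi(V_1)$ generates $V_2$ as a $\mathbb Q[H_2]$-module, then the averaging map $V_1^{H_1}\to V_2^{H_2}$, $v\mapsto\overline{\phi(v)}$, is surjective. (2) Let $V$ be a finitely generated $\mathrm{FI}_W$-module over a field of characteristic zero that is generated in stage $d$. Then the averaging map $V_n^{W_n}\to V_{n+1}^{W_{n+1}}$ (induced by the structure map) is surjective for $n\ge d$. If moreover $V$ has stable range $n\ge N$ with multiplicities $c_{\lambda,n}$, then it is an isomorphism for all $n\ge\max(N,d)$, except possibly, in type D, for $n=d\ge1$ when $c_{(\emptyset,(n)),n}\ne0$.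 (3) Let $V$ be a finitely generated $\mathrm{FI}_W\#$-module (type A or B/C) over a field of characteristic zero whose underlying $\mathrm{FI}_W$-module is generated in stage $d$. Then the averaging map $V_n^{W_n}\to V_{n+1}^{W_{n+1}}$ is an isomorphism for all $n\ge d$. -/

import Mathlib

open CategoryTheory

namespace FIW

universe u v

/-! ## Signed sets and their maps -/

/-- The classical families of Weyl groups; types B and C have the same Weyl groups `B_n`. -/
inductive WeylType
  | A
  | BC
  | D

/-- The set `{±1, …, ±n}`: the pair `(i, s)` stands for `s · (i + 1)`. -/
abbrev Signed (n : ℕ) : Type := Fin n × ℤˣ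

/-- The involution `t ↦ -t` of `{±1, …, ±n}`. -/
def flip {n : ℕ} (t : Signed n) : Signed n := (t.1, -t.2)

/-- The extra condition on a map of signed sets: in type A it preserves all signs; in type D, if it
is an endomorphism, then the number of positive elements sent to negative ones is even (that is, the
product of the signs of the images of `1, …, n` is `1`); no condition in type B/C. -/
def SignCond : WeylType → ∀ {m n : ℕ}, (Signed m → Signed n) → Prop
  | .A, _, _, f => ∀ t, (f t).2 = t.2
  | .BC, _, _, _ => True
  | .D, m, n, f => m = n → ∏ i : Fin m, (f (i, 1)).2 = 1

/-- The morphisms of `FI_W`: injections `φ` with `φ (-t) = -φ t` and the extra sign condition. -/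
structure IsFIMap (W : WeylType) {m n : ℕ} (f : Signed m → Signed n) : Prop where
  inj : Function.Injective f
  map_flip : ∀ t, f (flip t) = flip (f t)
  signCond : SignCond W f

theorem snd_apply {m n : ℕ} {f : Signed m → Signed n} (hf : ∀ t, f (flip t) = flip (f t))
    (t : Signed m) : (f t).2 = t.2 * (f (t.1, 1)).2 := by
  obtain ⟨i, s⟩ := t
  rcases Int.units_eq_one_or s with rfl | rfl
  · simp
  · have h := hf (i, 1)
    simp only [flip] at h
    simp [h]

theorem fst_injective {m n : ℕ} {f : Signed m → Signed n} (hi : Function.Injective f)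
    (hf : ∀ t, f (flip t) = flip (f t)) : Function.Injective fun i => (f (i, 1)).1 := by
  intro i j h
  simp only at h
  have key : f (i, 1) = f (j, 1) ∨ f (i, 1) = f (flip (j, 1)) := by
    rw [hf]
    rcases Int.units_eq_one_or (f (i, 1)).2 with h1 | h1 <;>
      rcases Int.units_eq_one_or (f (j, 1)).2 with h2 | h2 <;>
      simp [Prod.ext_iff, flip, h, h1, h2]
  rcases key with h' | h'
  · exact congrArg Prod.fst (hi h')
  · exact congrArg Prod.fst (hi h')

theorem IsFIMap.le {W : WeylType} {m n : ℕ} {f : Signed m → Signed n} (hf : IsFIMap W f) :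
    m ≤ n := by
  simpa using Fintype.card_le_of_injective _ (fst_injective hf.inj hf.map_flip)

theorem IsFIMap.id (W : WeylType) (n : ℕ) : IsFIMap W (fun t : Signed n => t) where
  inj := fun _ _ h => h
  map_flip := fun _ => rfl
  signCond := by cases W <;> simp [SignCond]

theorem prod_comp {m : ℕ} {f g : Signed m → Signed m} (hfi : Function.Injective f)
    (hf : ∀ t, f (flip t) = flip (f t)) (hg : ∀ t, g (flip t) = flip (g t)) :
    ∏ i : Fin m, (g (f (i, 1))).2 = (∏ i : Fin m, (f (i, 1)).2) * ∏ i : Fin m, (g (i, 1)).2 := by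
  have hb : Function.Bijective fun i => (f (i, 1)).1 :=
    Finite.injective_iff_bijective.1 (fst_injective hfi hf)
  rw [← hb.prod_comp (fun i => (g (i, 1)).2), ← Finset.prod_mul_distrib]
  exact Finset.prod_congr rfl fun i _ => snd_apply hg _

theorem IsFIMap.comp {W : WeylType} {m n p : ℕ} {f : Signed m → Signed n} {g : Signed n → Signed p}
    (hf : IsFIMap W f) (hg : IsFIMap W g) : IsFIMap W (fun t => g (f t)) where
  inj := fun _ _ h => hf.inj (hg.inj h)
  map_flip := fun t => by rw [hf.map_flip, hg.map_flip]
  signCond := by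
    have hfs := hf.signCond
    have hgs := hg.signCond
    have h1 := hf.le
    have h2 := hg.le
    cases W with
    | A => exact fun t => (hgs (f t)).trans (hfs t)
    | BC => trivial
    | D =>
      intro h
      obtain rfl : m = n := by omega
      subst h
      rw [prod_comp hf.inj hf.map_flip hg.map_flip, hfs rfl, hgs rfl, one_mul]

/-! ## The category `FI_W` and the Weyl groups -/

/-- Objects of `FI_W`: the sets `{±1, …, ±n}` for `n ≥ 0`. -/
structure FI (W : WeylType) where
  n : ℕ

instance (W : WeylType) : Category (FI W) where
  Hom X Y := {f : Signed X.n → Signed Y.n // IsFIMap W f}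
  id X := ⟨fun t => t, IsFIMap.id W X.n⟩
  comp f g := ⟨fun t => g.1 (f.1 t), f.2.comp g.2⟩

/-- The Weyl group `W_n`, the group of automorphisms of `{±1, …, ±n}` in `FI_W`: the symmetric group
`S_n` in type A, the signed permutations `B_n` in type B/C, the even signed permutations `D_n` in
type D. -/
def weylGroup (W : WeylType) (n : ℕ) : Subgroup (Equiv.Perm (Signed n)) where
  carrier := {σ | IsFIMap W σ}
  one_mem' := IsFIMap.id W n
  mul_mem' := fun {a b} ha hb => IsFIMap.comp (f := b) (g := a) hb ha
  inv_mem' := by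
    intro σ hσ
    have hflip : ∀ t, σ⁻¹ (flip t) = flip (σ⁻¹ t) := fun t => by
      apply σ.injective
      rw [hσ.map_flip]
      simp
    refine ⟨(σ⁻¹).injective, hflip, ?_⟩
    have hs := hσ.signCond
    cases W with
    | A =>
      intro t
      have := hs (σ⁻¹ t)
      simpa using this.symm
    | BC => trivial
    | D =>
      intro _
      have h := prod_comp (f := ⇑σ⁻¹) (g := ⇑σ) (σ⁻¹).injective hflip hσ.map_flip
      rw [hs rfl] at h
      simpa using h.symm

/-- An element of `W_n` as an endomorphism in `FI_W`. -/
def weylHom {W : WeylType} {n : ℕ} (w : weylGroup W n) : (⟨n⟩ : FI W) ⟶ ⟨n⟩ := ⟨w.1, w.2⟩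

/-- The standard inclusion `i_n : {±1, …, ±n} → {±1, …, ±(n+1)}`. -/
def stdIncl (W : WeylType) (n : ℕ) : (⟨n⟩ : FI W) ⟶ ⟨n + 1⟩ :=
  ⟨fun t => (t.1.castSucc, t.2),
    { inj := fun s t h => by simpa [Prod.ext_iff] using h
      map_flip := fun _ => rfl
      signCond := by cases W <;> simp [SignCond] }⟩

/-! ## Averaging -/

section Averaging

variable {k G V : Type*} [Field k] [CharZero k] [Group G] [Finite G] [AddCommGroup V] [Module k V]

/-- The averaging map `V → V^G`, `v ↦ |G|⁻¹ ∑ g, g • v`. -/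
noncomputable def averaging (ρ : Representation k G V) : V →ₗ[k] ρ.invariants :=
  letI := Fintype.ofFinite G
  letI : Invertible (Fintype.card G : k) :=
    invertibleOfNonzero (Nat.cast_ne_zero.2 Fintype.card_ne_zero)
  ρ.averageMap.codRestrict ρ.invariants ρ.averageMap_invariant

/-- The map `V₁^{G₁} → V₂^{G₂}`, `v ↦ average of φ v`, attached to a linear map `φ : V₁ → V₂`. -/
noncomputable def averagedMap {G₁ V₁ : Type*} [Group G₁] [AddCommGroup V₁] [Module k V₁]
    (ρ₁ : Representation k G₁ V₁) (ρ : Representation k G V) (φ : V₁ →ₗ[k] V) :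
    ρ₁.invariants →ₗ[k] ρ.invariants :=
  averaging ρ ∘ₗ φ ∘ₗ ρ₁.invariants.subtype

end Averaging

/-! ## `FI_W`-modules -/

section Modules

variable {W : WeylType} {k : Type u} [Field k]

/-- The `W_n`-representation `V_n` underlying an `FI_W`-module `V`. -/
def rep (V : FI W ⥤ ModuleCat.{v} k) (n : ℕ) : Representation k (weylGroup W n) (V.obj ⟨n⟩) where
  toFun w := (V.map (weylHom w)).hom
  map_one' := by
    have : weylHom (1 : weylGroup W n) = 𝟙 (⟨n⟩ : FI W) := rfl
    rw [this, V.map_id]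
    rfl
  map_mul' a b := by
    have : weylHom (a * b) = weylHom b ≫ weylHom a := rfl
    rw [this, V.map_comp]
    rfl

/-- The structure map `V_n → V_{n+1}` of an `FI_W`-module. -/
def structureMap (V : FI W ⥤ ModuleCat.{v} k) (n : ℕ) : V.obj ⟨n⟩ →ₗ[k] V.obj ⟨n + 1⟩ :=
  (V.map (stdIncl W n)).hom

/-- The averaging map `V_n^{W_n} → V_{n+1}^{W_{n+1}}`. -/
noncomputable def stageMap [CharZero k] (V : FI W ⥤ ModuleCat.{v} k) (n : ℕ) :
    (rep V n).invariants →ₗ[k] (rep V (n + 1)).invariants :=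
  averagedMap (rep V n) (rep V (n + 1)) (structureMap V n)

/-- `V` is generated in stage (at most) `d`: for `m ≥ d` the images of `V_d` under all morphisms
span `V_m`. -/
def GeneratedInStage (V : FI W ⥤ ModuleCat.{v} k) (d : ℕ) : Prop :=
  ∀ m, d ≤ m → Submodule.span k
    (⋃ f : (⟨d⟩ : FI W) ⟶ ⟨m⟩, Set.range fun x : V.obj ⟨d⟩ => (V.map f).hom x) = ⊤

/-- `V` is finitely generated. -/
def FinitelyGenerated (V : FI W ⥤ ModuleCat.{v} k) : Prop :=
  ∃ n, GeneratedInStage V n ∧ FiniteDimensional k (V.obj ⟨n⟩)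

end Modules

/-! ## The representations `V_λ` of symmetric and hyperoctahedral groups -/

section Specht

/-- The type whose Weyl groups carry the representations indexed by (double) partitions: for type D
these are the groups `B_n ≥ D_n`. -/
def WeylType.cover : WeylType → WeylType
  | .A => .A
  | .BC => .BC
  | .D => .BC

theorem weylGroup_le_cover (W : WeylType) (n : ℕ) : weylGroup W n ≤ weylGroup W.cover n := by
  intro σ hσ
  refine ⟨hσ.inj, hσ.map_flip, ?_⟩
  have := hσ.signCond
  cases W with
  | A => exact this
  | BC => trivial
  | D => trivial

/-- A permutation of `{1, …, n}` as a sign-preserving element of `W_n`. -/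
def permToWeyl (W : WeylType) {n : ℕ} (σ : Equiv.Perm (Fin n)) : weylGroup W n :=
  ⟨Equiv.prodCongr σ (Equiv.refl _),
    { inj := Equiv.injective _
      map_flip := fun _ => rfl
      signCond := by cases W <;> simp [SignCond] }⟩

/-- The cells of a pair of Young diagrams. -/
abbrev Cells (μ ν : YoungDiagram) : Type := {c // c ∈ μ.cells} ⊕ {c // c ∈ ν.cells}

/-- The row of a cell, in the first or in the second diagram. -/
def rowOf {μ ν : YoungDiagram} : Cells μ ν → ℕ ⊕ ℕ := Sum.map (fun c => c.1.1) (fun c => c.1.1)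

/-- The column of a cell, in the first or in the second diagram. -/
def colOf {μ ν : YoungDiagram} : Cells μ ν → ℕ ⊕ ℕ := Sum.map (fun c => c.1.2) (fun c => c.1.2)

/-- A numbering of the cells of a pair of Young diagrams (the choice does not affect the isomorphism
class of the representation below). -/
noncomputable def tableau {n : ℕ} (μ ν : YoungDiagram) (h : μ.card + ν.card = n) :
    Fin n ≃ Cells μ ν :=
  (Fintype.equivFinOfCardEq (by simpa [YoungDiagram.card] using h)).symm

variable (k : Type u) [Field k] (W : WeylType) {n : ℕ} {μ ν : YoungDiagram}

open scoped Classical in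
/-- The sum of the elements of `W_n` that preserve the rows of the tableau `T` up to signs, each
weighted by the product of its signs at the entries of the second diagram. -/
noncomputable def rowSum (T : Fin n ≃ Cells μ ν) : MonoidAlgebra k (weylGroup W n) :=
  ∑ w : weylGroup W n with ∀ i, rowOf (T (w.1 (i, 1)).1) = rowOf (T i),
    (((∏ i : Fin n with (T i).isRight, (w.1 (i, 1)).2 : ℤˣ) : ℤ) : k) • MonoidAlgebra.of k _ w

open scoped Classical in
/-- The sum, weighted by `sign`, of the permutations that preserve the columns of the tableau. -/
noncomputable def colSum (T : Fin n ≃ Cells μ ν) : MonoidAlgebra k (weylGroup W n) :=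
  ∑ σ : Equiv.Perm (Fin n) with ∀ i, colOf (T (σ i)) = colOf (T i),
    ((Equiv.Perm.sign σ : ℤ) : k) • MonoidAlgebra.of k _ (permToWeyl W σ)

/-- The left ideal of the group algebra `k[W_n]` generated by the Young symmetrizer of a tableau. -/
noncomputable def spechtIdeal (T : Fin n ≃ Cells μ ν) : Submodule k (MonoidAlgebra k (weylGroup W n)) :=
  LinearMap.range (LinearMap.mulRight k (rowSum k W T * colSum k W T))

/-- The irreducible representation of `W_n` attached to a pair of Young diagrams with `n` cells in
total, as the left ideal generated by a Young symmetrizer (`k` of characteristic zero). In type A,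
with the second diagram empty, this is the irreducible `V_μ` of `S_n`, trivial for `μ = (n)`. In type
B/C this is the irreducible `V_(μ,ν)` of `B_n`, namely
`Ind (V_μ ⊠ (V_ν ⊗ ε))` from `B_|μ| × B_|ν|`, where `V_μ`, `V_ν` are pulled back from symmetric
groups and `ε` is the product of the signs; it is trivial for `((n), ∅)`. -/
noncomputable def specht (T : Fin n ≃ Cells μ ν) :
    Representation k (weylGroup W n) (spechtIdeal k W T) :=
  (Representation.leftRegular k (weylGroup W n)).subrepresentation (spechtIdeal k W T) (by
    rintro g _ ⟨y, rfl⟩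
    refine ⟨MonoidAlgebra.of k _ g * y, ?_⟩
    rw [← Representation.asAlgebraHom_of, Representation.asAlgebraHom_ofMulAction_smul_eq_mul]
    simp [mul_assoc])

end Specht

/-! ## Stable families of representations -/

section Stability

/-- The Young diagram obtained by putting a row of length `r` on top of `μ`. -/
def addRow (r : ℕ) (μ : YoungDiagram) (h : μ.rowLen 0 ≤ r) : YoungDiagram where
  cells := ({0} ×ˢ Finset.range r) ∪
    μ.cells.map ⟨fun c => (c.1 + 1, c.2), fun a b h => by simpa [Prod.ext_iff] using h⟩
  isLowerSet := by
    rintro ⟨a, b⟩ ⟨a', b'⟩ hle hmem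
    obtain ⟨h1, h2⟩ : a' ≤ a ∧ b' ≤ b := hle
    simp only [Finset.coe_union, Set.mem_union, Finset.mem_coe, Finset.mem_product,
      Finset.mem_singleton, Finset.mem_range, Finset.mem_map, YoungDiagram.mem_cells] at hmem ⊢
    rcases hmem with ⟨rfl, hb⟩ | ⟨⟨i, j⟩, hij, he⟩
    · exact Or.inl ⟨by omega, by omega⟩
    · obtain ⟨rfl, rfl⟩ : i + 1 = a ∧ j = b := Prod.ext_iff.1 he
      rcases a' with _ | a'
      · have := YoungDiagram.mem_iff_lt_rowLen.1 (μ.up_left_mem (Nat.zero_le i) le_rfl hij)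
        exact Or.inl ⟨rfl, by omega⟩
      · exact Or.inr ⟨(a', b'), μ.up_left_mem (by omega) h2 hij, rfl⟩

theorem card_addRow (r : ℕ) (μ : YoungDiagram) (h : μ.rowLen 0 ≤ r) :
    (addRow r μ h).card = r + μ.card := by
  rw [YoungDiagram.card, addRow, Finset.card_union_of_disjoint]
  · simp
  · rw [Finset.disjoint_left]
    rintro ⟨a, b⟩ h1 h2
    simp only [Finset.mem_product, Finset.mem_singleton, Finset.mem_map] at h1 h2
    obtain ⟨⟨i, j⟩, -, he⟩ := h2
    have h3 : i + 1 = a := congrArg Prod.fst he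
    omega

/-- The labels `λ`: partitions in type A, double partitions `(λ⁺, λ⁻)` in the other types. A partition
`λ` in type A is encoded as `(λ, ∅)`. -/
structure Label (W : WeylType) where
  pos : YoungDiagram
  neg : YoungDiagram
  neg_eq_bot : W = .A → neg = ⊥

/-- The size `|λ|`. -/
def Label.size {W : WeylType} (l : Label W) : ℕ := l.pos.card + l.neg.card

/-- `V(λ)_n` is defined, that is, `n ≥ |λ| + λ⁺₁`. -/
def Label.Defined {W : WeylType} (l : Label W) (n : ℕ) : Prop := l.size + l.pos.rowLen 0 ≤ n

/-- The numbered cells of the padded (double) partition `λ[n]`, which is `(n - |λ|, λ)` in type A and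
`((n - |λ|, λ⁺), λ⁻)` in the other types. -/
noncomputable def Label.paddedTableau {W : WeylType} (l : Label W) {n : ℕ} (h : l.Defined n) :
    Fin n ≃ Cells (addRow (n - l.size) l.pos (Nat.le_sub_of_add_le' h)) l.neg :=
  tableau _ _ (by
    have h' : l.size + l.pos.rowLen 0 ≤ n := h
    have hs : l.size = l.pos.card + l.neg.card := rfl
    rw [card_addRow]
    omega)

variable {W : WeylType} {k : Type u} [Field k]

/-- The representation `V(λ)_n` of `W_n`: it is `V_{λ[n]}` in types A, B, C, and the restriction of
the `B_n`-representation `V_{λ[n]}` to `D_n` in type D. -/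
noncomputable def stableRep (k : Type u) [Field k] (l : Label W) {n : ℕ} (h : l.Defined n) :
    Representation k (weylGroup W n) (spechtIdeal k W.cover (l.paddedTableau h)) :=
  (specht k W.cover (l.paddedTableau h)).comp (Subgroup.inclusion (weylGroup_le_cover W n))

/-- `V_n` is isomorphic, as a `W_n`-representation, to the direct sum of `c λ` copies of `V(λ)_n`,
over all labels `λ` for which `V(λ)_n` is defined. -/
def Decomposes (V : FI W ⥤ ModuleCat.{v} k) (n : ℕ) (c : Label W → ℕ) : Prop :=
  Nonempty ((rep V n).Equiv (Representation.directSum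
    fun x : (Σ l : {l : Label W // l.Defined n}, Fin (c l.1)) => stableRep k x.1.1 x.1.2))

/-- Representation stability: eventual injectivity, eventual surjectivity, and eventually constant
multiplicities. -/
structure RepresentationStable (V : FI W ⥤ ModuleCat.{v} k) : Prop where
  injectivity : ∃ N, ∀ n, N ≤ n → Function.Injective (structureMap V n)
  surjectivity : ∃ N, ∀ n, N ≤ n → Submodule.span k
    {y | ∃ (w : weylGroup W (n + 1)) (x : V.obj ⟨n⟩), y = rep V (n + 1) w (structureMap V n x)} = ⊤
  multiplicities : ∃ (N : ℕ) (c : Label W → ℕ → ℕ), (∀ n, N ≤ n → Decomposes V n (c · n)) ∧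
    ∀ l, ∃ M, ∀ n, M ≤ n → c l n = c l M

/-- `V` is uniformly representation stable with stable range `n ≥ N`, with multiplicities `c`: for
`n ≥ N` the number `c λ n` is the multiplicity of `V(λ)_n` in a decomposition of `V_n`, and it does
not depend on `n`. The value `c λ n` is irrelevant when `V(λ)_n` is not defined. -/
structure HasStableRange (V : FI W ⥤ ModuleCat.{v} k) (N : ℕ) (c : Label W → ℕ → ℕ) : Prop where
  stable : RepresentationStable V
  decomposes : ∀ n, N ≤ n → Decomposes V n (c · n)
  constant : ∀ (l : Label W) (m n : ℕ), N ≤ m → N ≤ n → l.Defined m → l.Defined n → c l m = c l n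

/-- The double partition `(∅, (n))` of `n`, in type D. -/
def negRow (n : ℕ) : Label .D where
  pos := ⊥
  neg := addRow n ⊥ (by simp [YoungDiagram.rowLen_eq_card, YoungDiagram.row])
  neg_eq_bot := fun h => nomatch h

/-- The exceptional pairs `(n, d)` in type D: `n = d ≥ 1` and the decomposition of `V_n` uses the
representation `V((∅, (n)))_n`, which is a second name for the trivial representation of `D_n`. -/
def Exceptional : (W : WeylType) → (Label W → ℕ → ℕ) → ℕ → ℕ → Prop
  | .D, c, n, d => n = d ∧ 1 ≤ n ∧ c (negRow n) n ≠ 0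
  | _, _, _, _ => False

end Stability

/-! ## `FI_W#`-modules -/

section Sharp

/-- The types for which `FI_W#` is defined: A and B/C. -/
inductive SharpType
  | A
  | BC

/-- The underlying type of a Weyl group family. -/
def SharpType.toWeyl : SharpType → WeylType
  | .A => .A
  | .BC => .BC

/-- The morphisms of `FI_W#`: based maps between the based sets `{0, ±1, …, ±n}` (with `0` encoded as
`none`) that are injective away from the preimage of `0` and commute with `t ↦ -t`; in type A they
also preserve signs. -/
structure IsSharpMap (W : SharpType) {m n : ℕ} (f : Option (Signed m) → Option (Signed n)) :
    Prop where
  map_none : f none = none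
  inj : ∀ s t, f s ≠ none → f s = f t → s = t
  map_flip : ∀ t, f (t.map flip) = (f t).map flip
  signs : W = .A → ∀ t u, f (some t) = some u → u.2 = t.2

theorem IsSharpMap.comp {W : SharpType} {m n p : ℕ} {f : Option (Signed m) → Option (Signed n)}
    {g : Option (Signed n) → Option (Signed p)} (hf : IsSharpMap W f) (hg : IsSharpMap W g) :
    IsSharpMap W (fun t => g (f t)) where
  map_none := by rw [hf.map_none, hg.map_none]
  inj := fun s t hs h => by
    have h1 := hg.inj _ _ hs h
    exact hf.inj s t (fun h0 => hs (by rw [h0, hg.map_none])) h1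
  map_flip := fun t => by rw [hf.map_flip, hg.map_flip]
  signs := fun hW t u h => by
    cases h' : f (some t) with
    | none => rw [h', hg.map_none] at h; simp at h
    | some v =>
      rw [h'] at h
      exact (hg.signs hW v u h).trans (hf.signs hW t v h')

/-- Objects of `FI_W#`: the based sets `{0, ±1, …, ±n}` for `n ≥ 0`. -/
structure FISharp (W : SharpType) where
  n : ℕ

instance (W : SharpType) : Category (FISharp W) where
  Hom X Y := {f : Option (Signed X.n) → Option (Signed Y.n) // IsSharpMap W f}
  id X := ⟨fun t => t,
    { map_none := rfl
      inj := fun _ _ _ h => h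
      map_flip := fun _ => rfl
      signs := fun _ t u h => by simp_all }⟩
  comp f g := ⟨fun t => g.1 (f.1 t), f.2.comp g.2⟩

/-- The canonical embedding `FI_W → FI_W#`, extending a map by `0 ↦ 0`. -/
def toSharp (W : SharpType) : FI W.toWeyl ⥤ FISharp W where
  obj X := ⟨X.n⟩
  map f := ⟨Option.map f.1,
    { map_none := rfl
      inj := fun s t _ h => Option.map_injective f.2.inj h
      map_flip := fun t => by
        cases t with
        | none => rfl
        | some t => exact congrArg some (f.2.map_flip t)
      signs := fun hW t u h => by
        subst hW
        have hs := f.2.signCond t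
        simp only [Option.map_some, Option.some.injEq] at h
        rw [← h]
        exact hs }⟩
  map_id X := by
    apply Subtype.ext
    funext t
    cases t <;> rfl
  map_comp f g := by
    apply Subtype.ext
    funext t
    cases t <;> rfl

/-- The `FI_W`-module underlying an `FI_W#`-module. -/
def underlying {W : SharpType} {k : Type u} [Field k] (V : FISharp W ⥤ ModuleCat.{v} k) :
    FI W.toWeyl ⥤ ModuleCat.{v} k :=
  toSharp W ⋙ V

end Sharp

end FIW

/-! Surjectivity. Averaging does not distinguish `v` from `g • v`. If the translates of `φ V₁` span
`V₂`, every average in `V₂` is therefore a combination of averages of `φ v`, and these equal the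
averages of `φ` applied to the average of `v`. For an `FI_W`-module and `n ≥ d`, every morphism from
`d` to `n + 1` factors through the standard inclusion up to an element of `W_{n+1}`
(`IsFIMap.exists_extend`), so `V_n` generates `V_{n+1}`.

Injectivity for `FI_W#`. For an invariant `x`, the sum `z` of the translates of its image by the
transpositions `(j, n+1)` is invariant and is `n + 1` times the averaged image. The retraction
killing `±(n+1)` sends `z` to `x + ∑ p_j x`, with `p_j` the commuting idempotents that forget `±j`.
Their sum has nonnegative eigenvalues, so `z = 0` forces `x = 0`.

Injectivity in the stable range. An invariant of `V(λ)_n` lies in a left ideal of a group algebra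
and is detected by the characters of the larger group that are trivial on `W_n`: the trivial one
and, in type D, the product of the signs. These are multiplicative and kill one factor of the Young
symmetrizer, unless `λ` is empty or, in type D, `λ = (∅, (n))`. With the latter excluded, `dim
V_n^{W_n} ≤ c_∅ ≤ dim V_{n+1}^{W_{n+1}}`, and a surjection between such spaces is bijective.

Type D. For `n > d` the label `(∅, (n))` does not occur. By stability it would occur in `V_{2n+1}`
too, giving a nonzero vector on which even sign changes act by the product of the signs over a set
`I` with more than `d` elements inside and outside. A generator from stage `d` misses some `i ∈ I`
and some `j ∉ I`; changing both signs fixes it, while the character takes the value `-1`. So this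
isotypic part of `V_{2n+1}` is zero (`eq_zero_of_rep_evenSignChange`). -/

namespace FIW

universe u v

/-! ### Averaging over a finite group. -/

section Averaging

variable {k G V : Type*} [Field k] [CharZero k] [Group G] [Finite G] [AddCommGroup V] [Module k V]

theorem coe_averaging_eq_smul_sum [inst : Fintype G] (ρ : Representation k G V) (v : V) :
    (averaging ρ v : V) = (Fintype.card G : k)⁻¹ • ∑ g, ρ g v := by
  obtain rfl : inst = Fintype.ofFinite G := Subsingleton.elim _ _
  simp [averaging, GroupAlgebra.average, invOf_eq_inv]

theorem averaging_of_mem (ρ : Representation k G V) {v : V} (hv : v ∈ ρ.invariants) :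
    averaging ρ v = ⟨v, hv⟩ := by
  have := Fintype.ofFinite G
  apply Subtype.ext
  rw [coe_averaging_eq_smul_sum]
  simp only [Representation.mem_invariants] at hv
  simp only [hv, Finset.sum_const, Finset.card_univ, ← Nat.cast_smul_eq_nsmul k]
  rw [inv_smul_smul₀ (Nat.cast_ne_zero.2 Fintype.card_ne_zero)]

theorem averaging_apply_apply (ρ : Representation k G V) (g : G) (v : V) :
    averaging ρ (ρ g v) = averaging ρ v := by
  have := Fintype.ofFinite G
  apply Subtype.ext
  rw [coe_averaging_eq_smul_sum, coe_averaging_eq_smul_sum]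
  congr 1
  rw [← (Group.mulRight_bijective g).sum_comp fun h => ρ h v]
  simp [map_mul]

variable {G₁ V₁ : Type*} [Group G₁] [Finite G₁] [AddCommGroup V₁] [Module k V₁]

/-- If the translates of the image of `φ` span, and `φ` is compatible with the group actions, then
averaging `φ` gives a surjection on invariants. -/
theorem averagedMap_surjective (ρ₁ : Representation k G₁ V₁) (ρ : Representation k G V)
    (φ : V₁ →ₗ[k] V) (hφ : ∀ h, ∃ h', ∀ v, φ (ρ₁ h v) = ρ h' (φ v))
    (hspan : Submodule.span k {y | ∃ (h : G) (v : V₁), y = ρ h (φ v)} = ⊤) :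
    Function.Surjective (averagedMap ρ₁ ρ φ) := by
  have := Fintype.ofFinite G₁
  -- Averaging first in `V₁` changes nothing, because `φ` turns each group translate of `v` into a
  -- group translate of `φ v`.
  have key : ∀ v, averagedMap ρ₁ ρ φ (averaging ρ₁ v) = averaging ρ (φ v) := by
    intro v
    have h : ∀ g, averaging ρ (φ (ρ₁ g v)) = averaging ρ (φ v) := fun g => by
      obtain ⟨g', hg'⟩ := hφ g
      rw [hg', averaging_apply_apply]
    simp only [averagedMap, LinearMap.comp_apply, Submodule.subtype_apply,
      coe_averaging_eq_smul_sum, map_smul, map_sum, h, Finset.sum_const, Finset.card_univ,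
      ← Nat.cast_smul_eq_nsmul k]
    rw [inv_smul_smul₀ (Nat.cast_ne_zero.2 Fintype.card_ne_zero)]
  have hr : ∀ u : V, averaging ρ u ∈ LinearMap.range (averagedMap ρ₁ ρ φ) := by
    intro u
    have hu : u ∈ Submodule.span k {y | ∃ (h : G) (v : V₁), y = ρ h (φ v)} := by
      rw [hspan]; trivial
    induction hu using Submodule.span_induction with
    | mem y hy =>
      obtain ⟨h, v, rfl⟩ := hy
      rw [averaging_apply_apply, ← key]
      exact ⟨_, rfl⟩
    | zero => rw [map_zero]; exact Submodule.zero_mem _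
    | add x y _ _ hx hy => rw [map_add]; exact Submodule.add_mem _ hx hy
    | smul a x _ hx => rw [map_smul]; exact Submodule.smul_mem _ _ hx
  rintro ⟨u, hu⟩
  rw [← averaging_of_mem ρ hu]
  exact hr u

end Averaging

/-! ## Signed permutations -/

/-- The signed permutation `t ↦ s |t| · σ t`. -/
def signedPerm {n : ℕ} (σ : Equiv.Perm (Fin n)) (s : Fin n → ℤˣ) : Equiv.Perm (Signed n) where
  toFun t := (σ t.1, t.2 * s t.1)
  invFun t := (σ.symm t.1, t.2 * s (σ.symm t.1))
  left_inv t := by simp [mul_assoc, Int.units_mul_self]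
  right_inv t := by simp [mul_assoc, Int.units_mul_self]

theorem signedPerm_apply {n : ℕ} (σ : Equiv.Perm (Fin n)) (s : Fin n → ℤˣ) (t : Signed n) :
    signedPerm σ s t = (σ t.1, t.2 * s t.1) := rfl

theorem signedPerm_mem {W : WeylType} {n : ℕ} {σ : Equiv.Perm (Fin n)} {s : Fin n → ℤˣ}
    (hA : W = .A → ∀ i, s i = 1) (hD : W = .D → ∏ i, s i = 1) :
    signedPerm σ s ∈ weylGroup W n := by
  refine ⟨(signedPerm σ s).injective, fun t => ?_, ?_⟩
  · simp [signedPerm_apply, flip]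
  · cases W with
    | A => intro t; simp [signedPerm_apply, hA rfl]
    | BC => trivial
    | D => intro _; simpa [signedPerm_apply] using hD rfl

theorem apply_eq_of_map_flip {m n : ℕ} {f : Signed m → Signed n}
    (hf : ∀ t, f (flip t) = flip (f t)) (t : Signed m) :
    f t = ((f (t.1, 1)).1, t.2 * (f (t.1, 1)).2) := by
  obtain ⟨i, s⟩ := t
  refine Prod.ext ?_ (snd_apply hf _)
  rcases Int.units_eq_one_or s with rfl | rfl
  · rfl
  · have h := hf (i, 1)
    simp only [flip] at h
    simp [h]

/-- An injection of signed sets into a strictly larger one extends to a Weyl group element. -/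
theorem IsFIMap.exists_extend {W : WeylType} {m n : ℕ} {f : Signed m → Signed (n + 1)}
    (hf : IsFIMap W f) (hm : m ≤ n) :
    ∃ w : weylGroup W (n + 1), ∀ t, w.1 (Fin.castLE (by omega) t.1, t.2) = f t := by
  classical
  set φ : Fin m → Fin (n + 1) := fun i => (f (i, 1)).1 with hφ
  have hφi : Function.Injective φ := fst_injective hf.inj hf.map_flip
  have hcl : Function.Injective (Fin.castLE (by omega : m ≤ n + 1)) := Fin.castLE_injective _
  let σ : Equiv.Perm (Fin (n + 1)) :=
    ((Equiv.ofInjective _ hcl).symm.trans (Equiv.ofInjective φ hφi)).extendSubtype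
  have hσ : ∀ i, σ (Fin.castLE (by omega) i) = φ i := fun i => by
    rw [Equiv.extendSubtype_apply_of_mem _ _ ⟨i, rfl⟩]
    rw [Equiv.trans_apply, Equiv.ofInjective_symm_apply]
    rfl
  let s₀ : Fin (n + 1) → ℤˣ := fun i => if h : i.1 < m then (f (⟨i, h⟩, 1)).2 else 1
  -- Since `m ≤ n`, the last point lies outside the domain of `f`. Its sign is free and is chosen to
  -- make the total product `1`, as type D requires.
  let s := Function.update s₀ (Fin.last n) (∏ i, s₀ i)
  have hlast : s₀ (Fin.last n) = 1 := dif_neg (by simpa using hm)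
  have hs : ∏ i, s i = 1 := by
    have h1 := Finset.prod_update_of_mem (Finset.mem_univ (Fin.last n)) s₀ (∏ i, s₀ i)
    have h2 := Finset.prod_update_of_mem (Finset.mem_univ (Fin.last n)) s₀ (s₀ (Fin.last n))
    rw [Function.update_eq_self, hlast, one_mul] at h2
    rw [h1, ← h2, Int.units_mul_self]
  have hA : W = .A → ∀ i, s i = 1 := by
    rintro rfl i
    have h0 : ∀ i, s₀ i = 1 := fun i => by
      simp only [s₀]
      split
      · exact hf.signCond _
      · rfl
    simp [s, h0, Function.update_apply]
  refine ⟨⟨signedPerm σ s, signedPerm_mem hA fun _ => hs⟩, fun t => ?_⟩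
  rw [apply_eq_of_map_flip hf.map_flip t]
  have hne : Fin.castLE (by omega : m ≤ n + 1) t.1 ≠ Fin.last n := fun h => by
    have := congrArg Fin.val h
    have := t.1.2
    simp at *
    omega
  have h1 : s (Fin.castLE (by omega) t.1) = (f (t.1, 1)).2 := by
    simp only [s, Function.update_of_ne hne, s₀]
    exact dif_pos t.1.2
  simp only [signedPerm_apply, hσ, h1, hφ]

/-- The standard inclusion `{±1, …, ±m} → {±1, …, ±n}`. -/
def inclLE (W : WeylType) {m n : ℕ} (h : m ≤ n) : (⟨m⟩ : FI W) ⟶ ⟨n⟩ :=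
  ⟨fun t => (Fin.castLE h t.1, t.2),
    { inj := fun s t h => by simpa [Prod.ext_iff] using h
      map_flip := fun _ => rfl
      signCond := by cases W <;> simp [SignCond] }⟩

/-! ### Surjectivity of the averaging maps. -/

section Modules

variable {W : WeylType} {k : Type u} [Field k]

theorem rep_apply (V : FI W ⥤ ModuleCat.{v} k) (n : ℕ) (w : weylGroup W n) (x : V.obj ⟨n⟩) :
    rep V n w x = (V.map (weylHom w)).hom x := rfl

theorem map_comp_apply (V : FI W ⥤ ModuleCat.{v} k) {X Y Z : FI W} (f : X ⟶ Y) (g : Y ⟶ Z)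
    (x : V.obj X) : (V.map (f ≫ g)).hom x = (V.map g).hom ((V.map f).hom x) := by
  rw [V.map_comp]
  rfl

/-- The injection `u` followed by the inclusion extends to a signed permutation. This replaces
equivariance along a homomorphism `W_n → W_{n+1}`. -/
theorem exists_structureMap_rep (V : FI W ⥤ ModuleCat.{v} k) (n : ℕ) (u : weylGroup W n) :
    ∃ w : weylGroup W (n + 1), ∀ x,
      structureMap V n (rep V n u x) = rep V (n + 1) w (structureMap V n x) := by
  have hf := (weylHom u ≫ stdIncl W n).2
  obtain ⟨w, hw⟩ := hf.exists_extend le_rfl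
  refine ⟨w, fun x => ?_⟩
  have h : weylHom u ≫ stdIncl W n = stdIncl W n ≫ weylHom w :=
    Subtype.ext (funext fun t => (hw t).symm)
  simp only [rep_apply, structureMap]
  rw [← map_comp_apply, ← map_comp_apply, h]

/-- A morphism from `d` to `n + 1` misses a point when `d ≤ n`, so it is the standard inclusion
followed by an element of `W_{n+1}`, and that inclusion passes through stage `n`. -/
theorem GeneratedInStage.span_structureMap {V : FI W ⥤ ModuleCat.{v} k} {d : ℕ}
    (hV : GeneratedInStage V d) {n : ℕ} (hn : d ≤ n) :
    Submodule.span k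
      {y | ∃ (w : weylGroup W (n + 1)) (x : V.obj ⟨n⟩), y = rep V (n + 1) w (structureMap V n x)}
      = ⊤ := by
  rw [eq_top_iff, ← hV (n + 1) (by omega)]
  apply Submodule.span_mono
  intro y hy
  obtain ⟨f, x, rfl⟩ := Set.mem_iUnion.1 hy
  obtain ⟨w, hw⟩ := f.2.exists_extend hn
  refine ⟨w, (V.map (inclLE W hn)).hom x, ?_⟩
  have h : f = inclLE W hn ≫ stdIncl W n ≫ weylHom w :=
    Subtype.ext (funext fun t => (hw t).symm)
  simp only [rep_apply, structureMap]
  rw [← map_comp_apply, ← map_comp_apply, ← h]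

theorem stageMap_surjective [CharZero k] {V : FI W ⥤ ModuleCat.{v} k} {d : ℕ}
    (hV : GeneratedInStage V d) {n : ℕ} (hn : d ≤ n) : Function.Surjective (stageMap V n) :=
  averagedMap_surjective _ _ _ (exists_structureMap_rep V n) (hV.span_structureMap hn)

end Modules

/-! ## `FI_W#`-modules -/

/-- A positive scalar plus a sum of commuting idempotents is injective in characteristic zero. -/
theorem eq_zero_of_smul_add_sum_idempotents {k M ι : Type*} [Field k] [CharZero k]
    [AddCommGroup M] [Module k M] (p : ι → M →ₗ[k] M) (hp : ∀ i x, p i (p i x) = p i x)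
    (hc : ∀ i j x, p i (p j x) = p j (p i x)) (s : Finset ι) (c : ℕ) (x : M)
    (h : ((c + 1 : ℕ) : k) • x + ∑ i ∈ s, p i x = 0) : x = 0 := by
  classical
  induction s using Finset.induction_on generalizing c x with
  | empty =>
    rw [Finset.sum_empty, add_zero] at h
    exact (smul_eq_zero.1 h).resolve_left (Nat.cast_ne_zero.2 c.succ_ne_zero)
  | insert a s ha ih =>
    rw [Finset.sum_insert ha] at h
    -- Applying `p a` gives the same kind of relation for `p a x` over the smaller set, with the
    -- scalar raised by one; hence the induction is over all `c`.
    have h1 : p a x = 0 := by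
      apply ih (c + 1)
      have h2 := congrArg (p a) h
      simp only [map_add, map_smul, map_sum, map_zero, hp] at h2
      rw [← h2, Nat.cast_add_one (c + 1), add_smul, one_smul, add_assoc]
      simp only [hc a]
    rw [h1, zero_add] at h
    exact ih c x h

section Sharp

variable {W : SharpType}

/-- The map of based signed sets that forgets all elements other than the ones in the domain of
the partial injection `g`. -/
def sharpMap {m n : ℕ} (g : Fin m → Option (Fin n))
    (hg : ∀ i j, g i ≠ none → g i = g j → i = j) : (⟨m⟩ : FISharp W) ⟶ ⟨n⟩ :=
  ⟨fun t => t.bind fun u => (g u.1).map fun i => (i, u.2),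
    { map_none := rfl
      inj := fun s t hs h => by
        rcases s with _ | ⟨i, a⟩
        · exact absurd rfl hs
        rcases t with _ | ⟨j, b⟩
        · exact absurd h hs
        simp only [Option.bind_some] at hs h
        cases hi : g i with
        | none => simp [hi] at hs
        | some i' =>
          cases hj : g j with
          | none => simp [hi, hj] at h
          | some j' =>
            simp only [hi, hj, Option.map_some, Option.some.injEq, Prod.mk.injEq] at h
            rw [hg i j (by simp [hi]) (by rw [hi, hj, h.1]), h.2]
      map_flip := fun t => by
        rcases t with _ | ⟨i, a⟩
        · rfl
        · cases hi : g i <;> simp [hi, flip]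
      signs := fun _ t u h => by
        cases hi : g t.1 with
        | none => simp [hi] at h
        | some i' =>
          simp only [Option.bind_some, hi, Option.map_some, Option.some.injEq] at h
          rw [← h] }⟩

/-- The retraction `{0, ±1, …, ±(n+1)} → {0, ±1, …, ±n}` that sends `±(n+1)` to `0`. -/
def retraction (W : SharpType) (n : ℕ) : (⟨n + 1⟩ : FISharp W) ⟶ ⟨n⟩ :=
  sharpMap (fun i => if h : i.1 < n then some ⟨i.1, h⟩ else none) (by
    intro i j hi h
    simp only [ne_eq, dite_eq_right_iff, reduceCtorEq, imp_false, not_not] at hi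
    by_cases hj : j.1 < n
    · simpa [hi, hj, Fin.ext_iff] using h
    · simp [hi, hj] at h)

/-- The idempotent of `{0, ±1, …, ±n}` that sends `±j` to `0` and fixes the other elements. -/
def forget (W : SharpType) {n : ℕ} (j : Fin n) : (⟨n⟩ : FISharp W) ⟶ ⟨n⟩ :=
  sharpMap (fun i => if i = j then none else some i) (by
    intro i i' hi h
    by_cases h1 : i = j
    · simp [h1] at hi
    · by_cases h2 : i' = j
      · simp [h1, h2] at h
      · simpa [h1, h2] using h)

theorem sharpHom_ext {m n : ℕ} {f g : (⟨m⟩ : FISharp W) ⟶ ⟨n⟩}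
    (h : ∀ (i : Fin m) (a : ℤˣ), f.1 (some (i, a)) = g.1 (some (i, a))) : f = g := by
  apply Subtype.ext
  funext t
  rcases t with _ | ⟨i, a⟩
  · rw [f.2.map_none, g.2.map_none]
  · exact h i a

theorem comp_val {m n p : ℕ} (f : (⟨m⟩ : FISharp W) ⟶ ⟨n⟩) (g : (⟨n⟩ : FISharp W) ⟶ ⟨p⟩) (t) :
    (f ≫ g).1 t = g.1 (f.1 t) := rfl

theorem forget_val {n : ℕ} (j i : Fin n) (a : ℤˣ) :
    (forget W j).1 (some (i, a)) = if i = j then none else some (i, a) := by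
  by_cases h : i = j <;> simp [forget, sharpMap, h]

theorem retraction_val {n : ℕ} (i : Fin (n + 1)) (a : ℤˣ) :
    (retraction W n).1 (some (i, a)) = if h : i.1 < n then some (⟨i.1, h⟩, a) else none := by
  by_cases h : i.1 < n <;> simp [retraction, sharpMap, h]

theorem forget_comp_val {n : ℕ} (j j' i : Fin n) (a : ℤˣ) :
    (forget W j ≫ forget W j').1 (some (i, a)) =
      if i = j ∨ i = j' then none else some (i, a) := by
  rw [comp_val, forget_val]
  by_cases h : i = j
  · rw [if_pos h, if_pos (Or.inl h), (forget W j').2.map_none]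
  · rw [if_neg h, forget_val]
    simp only [h, false_or]

theorem forget_comp_self {n : ℕ} (j : Fin n) : forget W j ≫ forget W j = forget W j :=
  sharpHom_ext fun i a => by rw [forget_comp_val, forget_val]; simp only [or_self]

theorem forget_comm {n : ℕ} (j j' : Fin n) :
    forget W j ≫ forget W j' = forget W j' ≫ forget W j :=
  sharpHom_ext fun i a => by rw [forget_comp_val, forget_comp_val]; simp only [or_comm]

/-- The transposition of `j` and `n + 1`, as an element of `W_{n+1}`. -/
def swapLast (W : WeylType) {n : ℕ} (j : Fin (n + 1)) : weylGroup W (n + 1) :=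
  permToWeyl W (Equiv.swap j (Fin.last n))

/-- The standard inclusion followed by the transposition of `j` and `n + 1`, in `FI_W#`. -/
def swapIncl (W : SharpType) {n : ℕ} (j : Fin (n + 1)) : (⟨n⟩ : FISharp W) ⟶ ⟨n + 1⟩ :=
  (toSharp W).map (stdIncl W.toWeyl n ≫ weylHom (swapLast W.toWeyl j))

theorem swapIncl_val {n : ℕ} (j : Fin (n + 1)) (i : Fin n) (a : ℤˣ) :
    (swapIncl W j).1 (some (i, a)) = some (Equiv.swap j (Fin.last n) i.castSucc, a) := rfl

/-- The transposition moves `j` to `n + 1`, which the retraction kills, and leaves the other points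
alone. -/
theorem swapIncl_retraction {n : ℕ} (j : Fin n) :
    swapIncl W j.castSucc ≫ retraction W n = forget W j := by
  apply sharpHom_ext
  intro i a
  rw [comp_val, forget_val, swapIncl_val, retraction_val]
  by_cases h : i = j
  · simp [h]
  · rw [Equiv.swap_apply_of_ne_of_ne (by simpa [Fin.ext_iff] using h) (Fin.castSucc_lt_last i).ne]
    simp [h]

theorem swapIncl_last_retraction (n : ℕ) :
    swapIncl W (Fin.last n) ≫ retraction W n = 𝟙 _ := by
  apply sharpHom_ext
  intro i a
  rw [comp_val, swapIncl_val, retraction_val]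
  simp
  rfl

/-- In types A and B/C, a Weyl group element that preserves `±(n+1)` restricts to `W_n`. -/
theorem exists_restrict {n : ℕ} (w : weylGroup W.toWeyl (n + 1))
    (hw : (w.1 (Fin.last n, 1)).1 = Fin.last n) :
    ∃ u : weylGroup W.toWeyl n,
      stdIncl W.toWeyl n ≫ weylHom w = weylHom u ≫ stdIncl W.toWeyl n := by
  have hne : ∀ t : Signed n, (w.1 (t.1.castSucc, t.2)).1 ≠ Fin.last n := fun t h => by
    rw [apply_eq_of_map_flip w.2.map_flip] at h
    have h1 : t.1.castSucc = Fin.last n :=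
      fst_injective w.2.inj w.2.map_flip (h.trans hw.symm)
    exact (Fin.castSucc_lt_last t.1).ne h1
  let g : Signed n → Signed n := fun t =>
    ((w.1 (t.1.castSucc, t.2)).1.castPred (hne t), (w.1 (t.1.castSucc, t.2)).2)
  have hg : ∀ t, ((g t).1.castSucc, (g t).2) = w.1 (t.1.castSucc, t.2) := fun t => by
    simp [g]
  have hi : Function.Injective g := fun s t h => by
    have h1 := (hg s).symm.trans ((congrArg (fun u : Signed n => (u.1.castSucc, u.2)) h).trans
      (hg t))
    simpa [Prod.ext_iff] using w.1.injective h1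
  have hgm : IsFIMap W.toWeyl g := by
    refine ⟨hi, fun t => ?_, ?_⟩
    · have h1 : (((g (flip t)).1.castSucc, (g (flip t)).2) : Signed (n + 1)) =
          flip ((g t).1.castSucc, (g t).2) := by
        rw [hg, hg]
        exact w.2.map_flip (t.1.castSucc, t.2)
      simpa [Prod.ext_iff, flip] using h1
    -- In type D this step would fail: `w` may change the sign of `n + 1`, and its restriction is
    -- then odd.
    · cases W with
      | A => exact fun t => w.2.signCond (t.1.castSucc, t.2)
      | BC => trivial
  refine ⟨⟨Equiv.ofBijective g (Finite.injective_iff_bijective.1 hi), hgm⟩, ?_⟩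
  exact Subtype.ext (funext fun t => (hg t).symm)

variable {k : Type u} [Field k]

/-- The transpositions represent the left cosets of the stabilizer of `{±(n+1)}`. By
`exists_restrict` this stabilizer fixes the image of an invariant vector, so `w` permutes the
translates. -/
theorem rep_swapLast_structureMap (V : FI W.toWeyl ⥤ ModuleCat.{v} k) {n : ℕ}
    {x : V.obj ⟨n⟩} (hx : x ∈ (rep V n).invariants) (w : weylGroup W.toWeyl (n + 1))
    (j : Fin (n + 1)) :
    rep V (n + 1) w (rep V (n + 1) (swapLast _ j) (structureMap V n x)) =
      rep V (n + 1) (swapLast _ (w.1 (j, 1)).1) (structureMap V n x) := by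
  set j' := (w.1 (j, 1)).1 with hj'
  obtain ⟨u, hu⟩ := exists_restrict ((swapLast _ j')⁻¹ * w * swapLast _ j) (by
    have h1 : (swapLast W.toWeyl j).1 (Fin.last n, 1) = (j, 1) :=
      Prod.ext (Equiv.swap_apply_right _ _) rfl
    have h2 : (swapLast W.toWeyl j')⁻¹.1 (j', (w.1 (j, 1)).2) = (Fin.last n, (w.1 (j, 1)).2) := by
      apply (swapLast W.toWeyl j').1.injective
      rw [Subgroup.coe_inv, Equiv.Perm.inv_def, Equiv.apply_symm_apply]
      exact Prod.ext (Equiv.swap_apply_right _ _).symm rfl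
    simp only [Subgroup.coe_mul, Equiv.Perm.mul_apply, h1]
    exact congrArg Prod.fst h2)
  have h3 : rep V (n + 1) ((swapLast _ j')⁻¹ * w * swapLast _ j) (structureMap V n x) =
      structureMap V n x := by
    rw [rep_apply, structureMap, ← map_comp_apply, hu, map_comp_apply, ← rep_apply V n u,
      (Representation.mem_invariants _ _).1 hx]
  have h4 := congrArg (rep V (n + 1) (swapLast _ j')) h3
  rw [← h4]
  simp only [← Module.End.mul_apply, ← map_mul]
  congr 2
  group

theorem stageMap_injective_of_retraction [CharZero k] (V : FI W.toWeyl ⥤ ModuleCat.{v} k) (n : ℕ)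
    (r : V.obj ⟨n + 1⟩ →ₗ[k] V.obj ⟨n⟩) (p : Fin n → V.obj ⟨n⟩ →ₗ[k] V.obj ⟨n⟩)
    (hp : ∀ i x, p i (p i x) = p i x) (hc : ∀ i j x, p i (p j x) = p j (p i x))
    (hr : ∀ j x, r (rep V (n + 1) (swapLast _ (Fin.castSucc j)) (structureMap V n x)) = p j x)
    (hr' : ∀ x, r (rep V (n + 1) (swapLast _ (Fin.last n)) (structureMap V n x)) = x) :
    Function.Injective (stageMap V n) := by
  rw [← LinearMap.ker_eq_bot, LinearMap.ker_eq_bot']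
  rintro ⟨x, hx⟩ h0
  set z := ∑ j, rep V (n + 1) (swapLast _ j) (structureMap V n x) with hz
  have hzinv : z ∈ (rep V (n + 1)).invariants := by
    rw [Representation.mem_invariants]
    intro w
    have hb : Function.Bijective fun j => (w.1 (j, 1)).1 :=
      Finite.injective_iff_bijective.1 (fst_injective w.2.inj w.2.map_flip)
    rw [hz, map_sum,
      ← hb.sum_comp fun j => rep V (n + 1) (swapLast _ j) (structureMap V n x)]
    exact Finset.sum_congr rfl fun j _ => rep_swapLast_structureMap V hx w j
  -- All summands of `z` have the same average, which is `0` by assumption; being invariant, `z` is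
  -- its own average.
  have hz0 : z = 0 := by
    have h1 : averaging (rep V (n + 1)) z = 0 := by
      rw [hz, map_sum]
      refine Finset.sum_eq_zero fun j _ => ?_
      rw [averaging_apply_apply]
      exact h0
    rw [averaging_of_mem _ hzinv] at h1
    exact congrArg Subtype.val h1
  have h2 := congrArg r hz0
  rw [hz, map_sum, map_zero, Fin.sum_univ_castSucc, hr'] at h2
  simp only [hr] at h2
  apply Subtype.ext
  refine eq_zero_of_smul_add_sum_idempotents p hp hc Finset.univ 0 x ?_
  rw [add_comm]
  simpa using h2

theorem stageMap_underlying_injective [CharZero k] (V : FISharp W ⥤ ModuleCat.{v} k) (n : ℕ) :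
    Function.Injective (stageMap (underlying V) n) := by
  have hpp : ∀ {X Y Z : FISharp W} (f : X ⟶ Y) (g : Y ⟶ Z) (x : V.obj X),
      (V.map g).hom ((V.map f).hom x) = (V.map (f ≫ g)).hom x := fun f g x => by
    rw [V.map_comp]; rfl
  have hs : ∀ (j : Fin (n + 1)) (x : V.obj ⟨n⟩),
      rep (underlying V) (n + 1) (swapLast _ j) (structureMap (underlying V) n x) =
        (V.map (swapIncl W j)).hom x := fun j x =>
    (map_comp_apply (underlying V) (stdIncl _ n) (weylHom (swapLast _ j)) x).symm
  refine stageMap_injective_of_retraction (underlying V) n (V.map (retraction W n)).hom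
    (fun j => (V.map (forget W j)).hom) (fun j x => ?_) (fun i j x => ?_) (fun j x => ?_)
    (fun x => ?_)
  · exact (hpp _ _ _).trans (by rw [forget_comp_self]; rfl)
  · exact (hpp _ _ _).trans ((by rw [forget_comm] : _ = _).trans (hpp _ _ _).symm)
  · exact (congrArg _ (hs _ x)).trans ((hpp _ _ _).trans (by rw [swapIncl_retraction]; rfl))
  · exact (congrArg _ (hs _ x)).trans ((hpp _ _ _).trans (by
      rw [swapIncl_last_retraction, V.map_id]; rfl))

end Sharp

/-! ## Sign changes -/

/-- The sign change with signs `s`, as an element of `W_n`. -/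
def signChange (W : WeylType) {n : ℕ} (s : Fin n → ℤˣ) (hA : W = .A → ∀ i, s i = 1)
    (hD : W = .D → ∏ i, s i = 1) : weylGroup W n :=
  ⟨signedPerm 1 s, signedPerm_mem hA hD⟩

theorem signChange_apply {W : WeylType} {n : ℕ} (s : Fin n → ℤˣ) (hA : W = .A → ∀ i, s i = 1)
    (hD : W = .D → ∏ i, s i = 1) (t : Signed n) :
    (signChange W s hA hD).1 t = (t.1, t.2 * s t.1) := rfl

/-- The product of the signs of a signed permutation. -/
def signProd (W : WeylType) (n : ℕ) : weylGroup W n →* ℤˣ where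
  toFun w := ∏ i, (w.1 (i, 1)).2
  map_one' := by simp
  map_mul' a b := by
    have h := prod_comp (f := b.1) (g := a.1) b.2.inj b.2.map_flip a.2.map_flip
    simpa [mul_comm] using h

theorem signProd_signChange {W : WeylType} {n : ℕ} (s : Fin n → ℤˣ) (hA : W = .A → ∀ i, s i = 1)
    (hD : W = .D → ∏ i, s i = 1) : signProd W n (signChange W s hA hD) = ∏ i, s i := by
  simp [signProd, signChange_apply]

theorem signProd_permToWeyl {W : WeylType} {n : ℕ} (σ : Equiv.Perm (Fin n)) :
    signProd W n (permToWeyl W σ) = 1 := by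
  simp [signProd, permToWeyl]

/-! ### Characters with values `±1` on group algebras. -/

section Character

variable (k : Type*) [Field k] {G : Type*} [Group G]

/-- The extension to the group algebra of a character with values `±1`. -/
noncomputable def charMap (χ : G →* ℤˣ) : MonoidAlgebra k G →ₐ[k] k :=
  MonoidAlgebra.lift k k G (((Int.castRingHom k : ℤ →+* k) : ℤ →* k).comp
    ((Units.coeHom ℤ).comp χ))

variable {k}

theorem charMap_of (χ : G →* ℤˣ) (g : G) :
    charMap k χ (MonoidAlgebra.of k G g) = ((χ g : ℤ) : k) := by
  simp [charMap]

theorem charMap_eq_sum [Fintype G] (χ : G →* ℤˣ) (x : MonoidAlgebra k G) :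
    charMap k χ x = ∑ g, x.coeff g * ((χ g : ℤ) : k) := by
  rw [charMap, MonoidAlgebra.lift_apply, Finsupp.sum_fintype _ _ (by simp)]
  simp

theorem sum_of_mul [Fintype G] (y : MonoidAlgebra k G) :
    (∑ g, MonoidAlgebra.of k G g) * y = charMap k 1 y • ∑ g, MonoidAlgebra.of k G g := by
  induction y using MonoidAlgebra.induction_on with
  | of g =>
    rw [charMap_of, Finset.sum_mul]
    simp only [← map_mul]
    rw [(Group.mulRight_bijective g).sum_comp fun h => MonoidAlgebra.of k G h]
    simp
  | add a b ha hb => rw [mul_add, ha, hb, map_add, add_smul]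
  | smul r a ha => rw [mul_smul_comm, ha, map_smul, smul_smul, smul_eq_mul]

end Character

/-! ## Young symmetrizers -/

section Symmetrizer

variable {k : Type u} [Field k] {W : WeylType} {n : ℕ} {μ ν : YoungDiagram}

theorem cells_ext {a b : Cells μ ν} (hr : rowOf a = rowOf b) (hc : colOf a = colOf b) : a = b := by
  rcases a with ⟨⟨a, a'⟩, ha⟩ | ⟨⟨a, a'⟩, ha⟩ <;> rcases b with ⟨⟨b, b'⟩, hb⟩ | ⟨⟨b, b'⟩, hb⟩ <;>
    simp_all [rowOf, colOf]

theorem isRight_eq_of_rowOf_eq {a b : Cells μ ν} (h : rowOf a = rowOf b) :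
    a.isRight = b.isRight := by
  have := congrArg Sum.isRight h
  simpa [rowOf] using this

open scoped Classical in
/-- The product of the signs `s` over the entries of the second diagram. -/
def rightSign (T : Fin n ≃ Cells μ ν) (s : Fin n → ℤˣ) : ℤˣ :=
  ∏ i : Fin n with (T i).isRight, s i

open scoped Classical in
theorem prod_right_comp (T : Fin n ≃ Cells μ ν) (w : weylGroup W n)
    (hw : ∀ i, rowOf (T (w.1 (i, 1)).1) = rowOf (T i)) (s : Fin n → ℤˣ) :
    rightSign T (fun i => s (w.1 (i, 1)).1) = rightSign T s := by
  have hb : Function.Bijective fun i => (w.1 (i, 1)).1 :=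
    Finite.injective_iff_bijective.1 (fst_injective w.2.inj w.2.map_flip)
  rw [rightSign, rightSign, Finset.prod_filter, Finset.prod_filter,
    ← hb.prod_comp fun i => if (T i).isRight then s i else 1]
  simp only [isRight_eq_of_rowOf_eq (hw _)]

/-- Left multiplication by a sign change permutes the terms. Since `w` preserves rows, it permutes
the entries of the second diagram, so every weight changes by the same factor. -/
theorem of_signChange_mul_rowSum (T : Fin n ≃ Cells μ ν) (s : Fin n → ℤˣ)
    (hA : W = .A → ∀ i, s i = 1) (hD : W = .D → ∏ i, s i = 1) :
    MonoidAlgebra.of k _ (signChange W s hA hD) * rowSum k W T =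
      ((rightSign T s : ℤ) : k) • rowSum k W T := by
  classical
  rw [rowSum, Finset.mul_sum, Finset.smul_sum]
  set e := signChange W s hA hD with he
  have hee : e * e = 1 := by
    apply Subtype.ext
    apply Equiv.ext
    intro t
    change e.1 (e.1 t) = t
    simp [he, signChange_apply, mul_assoc, Int.units_mul_self]
  have hfst : ∀ (w : weylGroup W n) i, ((e * w).1 (i, 1)).1 = (w.1 (i, 1)).1 := fun w i => rfl
  refine Finset.sum_nbij' (fun w => e * w) (fun w => e * w) ?_ ?_ ?_ ?_ ?_
  · intro w hw
    simp only [Finset.mem_filter, Finset.mem_univ, true_and] at hw ⊢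
    exact fun i => (by rw [hfst, hw i])
  · intro w hw
    simp only [Finset.mem_filter, Finset.mem_univ, true_and] at hw ⊢
    exact fun i => (by rw [hfst, hw i])
  · intro w _
    rw [← mul_assoc, hee, one_mul]
  · intro w _
    rw [← mul_assoc, hee, one_mul]
  · intro w hw
    simp only [Finset.mem_filter, Finset.mem_univ, true_and] at hw
    have h1 : rightSign T (fun i => ((e * w).1 (i, 1)).2) =
        rightSign T (fun i => (w.1 (i, 1)).2) * rightSign T s := by
      rw [← prod_right_comp T w hw s, rightSign, rightSign, rightSign, ← Finset.prod_mul_distrib]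
      rfl
    have h2 : rightSign T s * rightSign T (fun i => ((e * w).1 (i, 1)).2) =
        rightSign T (fun i => (w.1 (i, 1)).2) := by
      rw [h1, mul_comm, mul_assoc, Int.units_mul_self, mul_one]
    have h3 := congrArg (fun u : ℤˣ => ((u : ℤ) : k)) h2
    simp only [Units.val_mul, Int.cast_mul] at h3
    rw [mul_smul_comm, ← map_mul, smul_smul]
    exact congrArg (· • _) h3.symm

theorem charMap_rowSum_eq_zero [CharZero k] (T : Fin n ≃ Cells μ ν) (χ : weylGroup W n →* ℤˣ)
    (s : Fin n → ℤˣ) (hA : W = .A → ∀ i, s i = 1) (hD : W = .D → ∏ i, s i = 1)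
    (hne : χ (signChange W s hA hD) ≠ rightSign T s) : charMap k χ (rowSum k W T) = 0 := by
  have h := congrArg (charMap k χ) (of_signChange_mul_rowSum (k := k) T s hA hD)
  rw [map_mul, charMap_of, map_smul, smul_eq_mul] at h
  by_contra h0
  have h1 := mul_right_cancel₀ h0 h
  exact hne (Units.ext (by exact_mod_cast h1))

theorem charMap_colSum (T : Fin n ≃ Cells μ ν) (χ : weylGroup W n →* ℤˣ)
    (hχ : ∀ σ, χ (permToWeyl W σ) = 1) : charMap k χ (colSum k W T) =
      (open scoped Classical in
      ∑ σ : Equiv.Perm (Fin n) with ∀ i, colOf (T (σ i)) = colOf (T i),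
        ((Equiv.Perm.sign σ : ℤ) : k)) := by
  simp [colSum, map_sum, charMap_of, hχ, -MonoidAlgebra.of_apply]

/-- Multiplication by the transposition of two entries in one column pairs terms of opposite sign,
while `χ` is trivial on permutations. -/
theorem charMap_colSum_eq_zero (T : Fin n ≃ Cells μ ν) (χ : weylGroup W n →* ℤˣ)
    (hχ : ∀ σ, χ (permToWeyl W σ) = 1) {a b : Cells μ ν} (hab : a ≠ b)
    (hc : colOf a = colOf b) : charMap k χ (colSum k W T) = 0 := by
  classical
  rw [charMap_colSum T χ hχ]
  have hne : T.symm a ≠ T.symm b := T.symm.injective.ne hab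
  have hsw : ∀ i, colOf (T (Equiv.swap (T.symm a) (T.symm b) i)) = colOf (T i) := fun i => by
    by_cases h1 : i = T.symm a
    · rw [h1, Equiv.swap_apply_left, T.apply_symm_apply, T.apply_symm_apply, hc]
    by_cases h2 : i = T.symm b
    · rw [h2, Equiv.swap_apply_right, T.apply_symm_apply, T.apply_symm_apply, hc]
    rw [Equiv.swap_apply_of_ne_of_ne h1 h2]
  refine Finset.sum_involution (fun σ _ => σ * Equiv.swap (T.symm a) (T.symm b)) ?_ ?_ ?_ ?_
  · intro σ _
    simp [Equiv.Perm.sign_mul, Equiv.Perm.sign_swap hne]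
  · intro σ _ _ h
    exact hne (by simpa using h)
  · intro σ hσ
    simp only [Finset.mem_filter, Finset.mem_univ, true_and] at hσ ⊢
    intro i
    rw [Equiv.Perm.mul_apply, hσ, hsw]
  · intro σ _
    simp [mul_assoc]

theorem charMap_colSum_eq_one (T : Fin n ≃ Cells μ ν) (χ : weylGroup W n →* ℤˣ)
    (hχ : ∀ σ, χ (permToWeyl W σ) = 1) (hc : ∀ a b : Cells μ ν, colOf a = colOf b → a = b) :
    charMap k χ (colSum k W T) = 1 := by
  classical
  rw [charMap_colSum T χ hχ, Finset.sum_eq_single 1]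
  · simp
  · intro σ hσ h1
    simp only [Finset.mem_filter, Finset.mem_univ, true_and] at hσ
    exact absurd (Equiv.ext fun i => T.injective (hc _ _ (hσ i))) h1
  · intro h
    simp at h

theorem charMap_one_rowSum_ne_zero [CharZero k] (T : Fin n ≃ Cells μ ⊥) :
    charMap k 1 (rowSum k W T) ≠ 0 := by
  classical
  have hr : ∀ i, (T i).isRight = false := fun i => by
    rcases T i with a | ⟨c, hc⟩
    · rfl
    · simp at hc
  simp only [rowSum, hr, map_sum, map_smul, charMap_of]
  simp only [Bool.false_eq_true, Finset.filter_false, Finset.prod_empty, MonoidHom.one_apply,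
    Units.val_one, Int.cast_one, smul_eq_mul, mul_one, Finset.sum_const, nsmul_eq_mul]
  rw [Nat.cast_ne_zero, ← Nat.pos_iff_ne_zero, Finset.card_pos]
  exact ⟨1, by simp⟩

/-- The coefficient of `1` is `1`: if `w σ = 1`, then `σ` preserves both rows and columns, so `σ`
and `w` are trivial. -/
theorem rowSum_mul_colSum_ne_zero [CharZero k] (T : Fin n ≃ Cells μ ν) :
    rowSum k W T * colSum k W T ≠ 0 := by
  classical
  intro h
  have h1 : (rowSum k W T * colSum k W T).coeff 1 = 1 := by
    rw [rowSum, colSum, Finset.sum_mul_sum]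
    simp only [smul_mul_smul_comm, MonoidAlgebra.single_mul_single, mul_one, MonoidAlgebra.of_apply,
      MonoidAlgebra.coeff_sum,
      MonoidAlgebra.coeff_smul, MonoidAlgebra.coeff_single, Finsupp.finsetSum_apply,
      Finsupp.smul_apply, Finsupp.single_apply]
    rw [Finset.sum_eq_single 1, Finset.sum_eq_single 1]
    · have : permToWeyl W (1 : Equiv.Perm (Fin n)) = 1 := rfl
      simp [this]
    · intro σ _ hσ
      rw [if_neg, smul_zero]
      rw [one_mul]
      intro h2
      apply hσ
      ext i
      have h3 := congrArg (fun w : weylGroup W n => (w.1 (i, 1)).1) h2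
      exact congrArg Fin.val h3
    · intro h2
      simp at h2
    · intro w hw hw1
      refine Finset.sum_eq_zero fun σ hσ => ?_
      simp only [Finset.mem_filter, Finset.mem_univ, true_and] at hw hσ
      rw [if_neg, smul_zero]
      intro h2
      have h4 : ∀ i, w.1 (σ i, 1) = (i, 1) := fun i =>
        congrArg (fun w : weylGroup W n => w.1 (i, 1)) h2
      have h3 : σ = 1 := by
        apply Equiv.ext
        intro i
        apply T.injective
        refine cells_ext ?_ (hσ i)
        rw [← hw (σ i), h4]
        rfl
      subst h3
      exact hw1 (by simpa [show permToWeyl W (1 : Equiv.Perm (Fin n)) = 1 from rfl] using h2)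
    · intro h2
      simp at h2
  rw [h] at h1
  simp at h1

theorem coe_specht_apply (T : Fin n ≃ Cells μ ν) (g : weylGroup W n) (x : spechtIdeal k W T) :
    (specht k W T g x : MonoidAlgebra k (weylGroup W n)) = MonoidAlgebra.of k _ g * x := by
  rw [← Representation.asAlgebraHom_ofMulAction_smul_eq_mul, Representation.asAlgebraHom_of]
  rfl

theorem charMap_eq_zero_of_mem_spechtIdeal (T : Fin n ≃ Cells μ ν) (χ : weylGroup W n →* ℤˣ)
    (h : charMap k χ (rowSum k W T) = 0 ∨ charMap k χ (colSum k W T) = 0)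
    {x : MonoidAlgebra k (weylGroup W n)} (hx : x ∈ spechtIdeal k W T) : charMap k χ x = 0 := by
  obtain ⟨y, rfl⟩ := hx
  rw [LinearMap.mulRight_apply, map_mul, map_mul]
  rcases h with h | h <;> simp [h]

end Symmetrizer

/-! ## Invariants of the representations `V(λ)_n` -/

section Invariants

variable {k : Type u} [Field k] {W : WeylType} {n : ℕ}

theorem coeff_eq_of_mul_mem {W' : WeylType} (H : Subgroup (weylGroup W' n))
    {x : MonoidAlgebra k (weylGroup W' n)}
    (hx : ∀ w ∈ H, MonoidAlgebra.of k _ w * x = x) {g h : weylGroup W' n} (hgh : g * h⁻¹ ∈ H) :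
    x.coeff g = x.coeff h := by
  have h1 := congrArg (fun y => y.coeff g) (hx _ hgh)
  simp only [MonoidAlgebra.of_apply, MonoidAlgebra.coeff_single_mul_apply, one_mul] at h1
  rw [← h1]
  congr 1
  group

/-- An element of the group algebra of `W_n` (in type D, of `B_n`) that is fixed by `W_n` vanishes if
the characters of the larger group that are trivial on `W_n` vanish on it. -/
theorem eq_zero_of_charMap_eq_zero [CharZero k]
    {x : MonoidAlgebra k (weylGroup W.cover n)}
    (hx : ∀ w : weylGroup W n,
      MonoidAlgebra.of k _ (Subgroup.inclusion (weylGroup_le_cover W n) w) * x = x)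
    (h1 : charMap k 1 x = 0) (hD : W = .D → charMap k (signProd _ n) x = 0) : x = 0 := by
  classical
  have hx' : ∀ w ∈ (Subgroup.inclusion (weylGroup_le_cover W n)).range,
      MonoidAlgebra.of k _ w * x = x := by
    rintro _ ⟨w, rfl⟩
    exact hx w
  -- Invariance makes the coefficients constant on right cosets of `W_n`; in type D these are the
  -- fibres of `signProd`, otherwise there is only one.
  have hcoeff : ∀ g h, (W = .D → signProd _ n g = signProd _ n h) → x.coeff g = x.coeff h := by
    intro g h hgh
    apply coeff_eq_of_mul_mem _ hx'
    refine ⟨⟨(g * h⁻¹).1, ?_⟩, rfl⟩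
    refine ⟨(g * h⁻¹).2.inj, (g * h⁻¹).2.map_flip, ?_⟩
    have hs := (g * h⁻¹).2.signCond
    cases W with
    | A => exact hs
    | BC => trivial
    | D =>
      intro _
      have h2 : signProd _ n (g * h⁻¹) = 1 := by
        rw [map_mul, hgh rfl, map_inv, mul_inv_cancel]
      exact h2
  rw [charMap_eq_sum] at h1
  ext h
  rw [MonoidAlgebra.coeff_zero, Finsupp.zero_apply]
  by_cases hW : W = .D
  · have h2 := hD hW
    rw [charMap_eq_sum] at h2
    -- The combination `1 + χ(h) χ(g)`, with `χ = signProd`, is twice the indicator of the coset of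
    -- `h`, so the two vanishing character sums isolate that coset.
    have h3 : ∑ g, (if signProd W.cover n g = signProd _ n h then 2 * x.coeff h else 0) = 0 := by
      have h4 : ∀ g, (if signProd _ n g = signProd _ n h then 2 * x.coeff h else 0) =
          x.coeff g * (((1 : weylGroup W.cover n →* ℤˣ) g : ℤ) : k) +
            ((signProd _ n h : ℤ) : k) * (x.coeff g * ((signProd _ n g : ℤ) : k)) := by
        intro g
        split_ifs with hg
        · rw [hcoeff g h fun _ => hg, hg]
          rcases Int.units_eq_one_or (signProd _ n h) with h5 | h5 <;> simp [h5] <;> ring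
        · rcases Int.units_eq_one_or (signProd _ n h) with h5 | h5 <;>
            rcases Int.units_eq_one_or (signProd _ n g) with h6 | h6 <;>
            simp_all
      rw [Finset.sum_congr rfl fun g _ => h4 g, Finset.sum_add_distrib, ← Finset.mul_sum, h1, h2]
      simp
    rw [← Finset.sum_filter, Finset.sum_const, nsmul_eq_mul] at h3
    rcases mul_eq_zero.1 h3 with h4 | h4
    · rw [Nat.cast_eq_zero, Finset.card_eq_zero] at h4
      have : h ∈ (∅ : Finset (weylGroup W.cover n)) := by rw [← h4]; simp
      simp at this
    · simpa using h4
  · have h3 : ∀ g, x.coeff g = x.coeff h := fun g => hcoeff g h fun h => absurd h hW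
    simp only [h3, MonoidHom.one_apply, Units.val_one, Int.cast_one, mul_one, Finset.sum_const,
      Finset.card_univ, nsmul_eq_mul] at h1
    exact (mul_eq_zero.1 h1).resolve_left (Nat.cast_ne_zero.2 Fintype.card_ne_zero)

/-- The empty label. -/
def emptyLabel (W : WeylType) : Label W where
  pos := ⊥
  neg := ⊥
  neg_eq_bot := fun _ => rfl

theorem rowLen_bot (i : ℕ) : (⊥ : YoungDiagram).rowLen i = 0 := by
  simp [YoungDiagram.rowLen_eq_card, YoungDiagram.row]

theorem card_bot : (⊥ : YoungDiagram).card = 0 := by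
  simp [YoungDiagram.card]

theorem emptyLabel_size (W : WeylType) : (emptyLabel W).size = 0 := by
  simp [Label.size, emptyLabel, card_bot]

theorem emptyLabel_defined (W : WeylType) (n : ℕ) : (emptyLabel W).Defined n := by
  rw [Label.Defined, emptyLabel_size, emptyLabel, rowLen_bot]
  exact Nat.zero_le n

theorem diagram_ext {μ ν : YoungDiagram} (h : μ.cells = ν.cells) : μ = ν := by
  cases μ; cases ν; cases h; rfl

theorem exists_mem_of_ne_bot {μ : YoungDiagram} (h : μ ≠ ⊥) : (0, 0) ∈ μ := by
  by_contra h0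
  apply h
  apply diagram_ext
  rw [YoungDiagram.cells_bot, Finset.eq_empty_iff_forall_notMem]
  rintro ⟨a, b⟩ hab
  exact h0 (μ.up_left_mem (Nat.zero_le a) (Nat.zero_le b) hab)

theorem mem_addRow {r : ℕ} {μ : YoungDiagram} {h : μ.rowLen 0 ≤ r} {a b : ℕ} :
    (a, b) ∈ addRow r μ h ↔ (a = 0 ∧ b < r) ∨ ∃ i, i + 1 = a ∧ (i, b) ∈ μ := by
  rw [← YoungDiagram.mem_cells]
  simp only [addRow, Finset.mem_union, Finset.mem_product, Finset.mem_singleton,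
    Finset.mem_range, Finset.mem_map, YoungDiagram.mem_cells]
  constructor
  · rintro (h | ⟨⟨i, j⟩, hij, he⟩)
    · exact Or.inl h
    · obtain ⟨rfl, rfl⟩ : i + 1 = a ∧ j = b := Prod.ext_iff.1 he
      exact Or.inr ⟨i, rfl, hij⟩
  · rintro (h | ⟨i, rfl, h2⟩)
    · exact Or.inl h
    · exact Or.inr ⟨(i, b), h2, rfl⟩

theorem eq_addRow_bot {μ : YoungDiagram} (h : (1, 0) ∉ μ) :
    μ = addRow μ.card ⊥ (by rw [rowLen_bot]; exact Nat.zero_le _) := by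
  have h0 : ∀ c ∈ μ, c.1 = 0 := by
    rintro ⟨a, b⟩ hab
    by_contra ha
    exact h (μ.up_left_mem (by simp only at ha; omega) (Nat.zero_le b) hab)
  have hr : μ.row 0 = μ.cells := by
    apply Finset.filter_true_of_mem
    exact fun c hc => h0 c hc
  have hc : μ.card = μ.rowLen 0 := by rw [YoungDiagram.rowLen_eq_card, hr]
  apply SetLike.ext
  rintro ⟨a, b⟩
  rw [mem_addRow, hc]
  constructor
  · intro hab
    obtain rfl : a = 0 := h0 _ hab
    exact Or.inl ⟨rfl, YoungDiagram.mem_iff_lt_rowLen.1 hab⟩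
  · rintro (⟨rfl, hb⟩ | ⟨i, -, hi⟩)
    · exact YoungDiagram.mem_iff_lt_rowLen.2 hb
    · exact absurd hi (YoungDiagram.notMem_bot _)

theorem rightSign_mulSingle {μ ν : YoungDiagram} (T : Fin n ≃ Cells μ ν) (a : Cells μ ν) (u : ℤˣ) :
    rightSign T (Pi.mulSingle (T.symm a) u) = if a.isRight then u else 1 := by
  classical
  rw [rightSign, Finset.prod_pi_mulSingle']
  simp

/-- The change of the single sign at `a` multiplies the row sum by `-1`, but the trivial character
sends it to `1`. Single sign changes are available because the covering group is `B_n`. -/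
theorem charMap_rowSum_eq_zero_of_isRight [CharZero k] (hW : W ≠ .A) {μ ν : YoungDiagram}
    (T : Fin n ≃ Cells μ ν) {a : Cells μ ν} (ha : a.isRight) :
    charMap k 1 (rowSum k W.cover T) = 0 := by
  classical
  have hc : W.cover = .BC := by cases W <;> simp_all [WeylType.cover]
  refine charMap_rowSum_eq_zero T _ (Pi.mulSingle (T.symm a) (-1)) (fun h => ?_) (fun h => ?_) ?_
  · simp [hc] at h
  · simp [hc] at h
  · rw [rightSign_mulSingle, if_pos ha]
    simp

theorem charMap_signProd_rowSum_eq_zero_of_isLeft [CharZero k] (hW : W ≠ .A) {μ ν : YoungDiagram}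
    (T : Fin n ≃ Cells μ ν) {a : Cells μ ν} (ha : a.isRight = false) :
    charMap k (signProd _ n) (rowSum k W.cover T) = 0 := by
  classical
  have hc : W.cover = .BC := by cases W <;> simp_all [WeylType.cover]
  refine charMap_rowSum_eq_zero T _ (Pi.mulSingle (T.symm a) (-1)) (fun h => ?_) (fun h => ?_) ?_
  · simp [hc] at h
  · simp [hc] at h
  · rw [rightSign_mulSingle, if_neg (by simp [ha]), signProd_signChange,
      Finset.prod_pi_mulSingle', if_pos (Finset.mem_univ _)]
    simp

theorem invariant_iff (l : Label W) (h : l.Defined n) (x : spechtIdeal k W.cover (l.paddedTableau h)) :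
    x ∈ (stableRep k l h).invariants ↔ ∀ w : weylGroup W n, MonoidAlgebra.of k _
      (Subgroup.inclusion (weylGroup_le_cover W n) w) * x.1 = x.1 := by
  rw [Representation.mem_invariants]
  refine forall_congr' fun w => ?_
  rw [Subtype.ext_iff]
  exact Iff.of_eq (congrArg (· = _) (coe_specht_apply _ _ _))

/-- If the second diagram is empty, a nonempty `λ` puts two cells in the first column, which kills
the column sum. Otherwise a sign change at a cell of the second diagram kills the row sum. -/
theorem charMap_one_eq_zero [CharZero k] (l : Label W) (h : l.Defined n) (hl : l ≠ emptyLabel W)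
    {x : MonoidAlgebra k (weylGroup W.cover n)}
    (hx : x ∈ spechtIdeal k W.cover (l.paddedTableau h)) : charMap k 1 x = 0 := by
  apply charMap_eq_zero_of_mem_spechtIdeal _ _ ?_ hx
  by_cases hneg : l.neg = ⊥
  · have hpos : l.pos ≠ ⊥ := by
      intro hpos
      apply hl
      cases l
      simp only at hneg hpos
      subst hneg hpos
      rfl
    have h10 : (1, 0) ∈ addRow (n - l.size) l.pos (Nat.le_sub_of_add_le' h) :=
      mem_addRow.2 (Or.inr ⟨0, rfl, exists_mem_of_ne_bot hpos⟩)
    have h00 := YoungDiagram.up_left_mem _ (Nat.zero_le 1) le_rfl h10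
    right
    refine charMap_colSum_eq_zero _ _ (fun _ => rfl) (a := Sum.inl ⟨_, h00⟩)
      (b := Sum.inl ⟨_, h10⟩) ?_ rfl
    simp
  · left
    have hW : W ≠ .A := fun hW => hneg (l.neg_eq_bot hW)
    exact charMap_rowSum_eq_zero_of_isRight hW _
      (a := Sum.inr ⟨_, exists_mem_of_ne_bot hneg⟩) rfl

/-- A cell in the padded first diagram kills the row sum. If there is none, the second diagram has
`n` cells; not being a single row, it has two cells in one column. -/
theorem charMap_signProd_eq_zero [CharZero k] (l : Label .D) (h : l.Defined n)
    (hl : l ≠ negRow n) {x : MonoidAlgebra k (weylGroup WeylType.D.cover n)}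
    (hx : x ∈ spechtIdeal k WeylType.D.cover (l.paddedTableau h)) :
    charMap k (signProd _ n) x = 0 := by
  apply charMap_eq_zero_of_mem_spechtIdeal _ _ ?_ hx
  by_cases h0 : (0, 0) ∈ addRow (n - l.size) l.pos (Nat.le_sub_of_add_le' h)
  · left
    exact charMap_signProd_rowSum_eq_zero_of_isLeft (by simp) _ (a := Sum.inl ⟨_, h0⟩) rfl
  · right
    have hpos : l.pos = ⊥ := by
      by_contra hpos
      exact h0 (YoungDiagram.up_left_mem _ (Nat.zero_le 1) le_rfl
        (mem_addRow.2 (Or.inr ⟨0, rfl, exists_mem_of_ne_bot hpos⟩)))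
    have hn : ¬ 0 < n - l.size := fun hn => h0 (mem_addRow.2 (Or.inl ⟨rfl, hn⟩))
    have hsize : l.size = l.neg.card := by rw [Label.size, hpos, card_bot, zero_add]
    have hle : l.size + l.pos.rowLen 0 ≤ n := h
    have hcard : l.neg.card = n := by omega
    have h10 : (1, 0) ∈ l.neg := by
      by_contra h10
      apply hl
      have := eq_addRow_bot h10
      cases l
      simp only at hpos this hcard
      subst hpos
      subst hcard
      simp only [negRow, Label.mk.injEq, true_and]
      exact this
    have h00 := YoungDiagram.up_left_mem _ (Nat.zero_le 1) le_rfl h10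
    refine charMap_colSum_eq_zero _ _ signProd_permToWeyl (a := Sum.inr ⟨_, h00⟩)
      (b := Sum.inr ⟨_, h10⟩) ?_ rfl
    simp

theorem stableRep_invariant_eq_zero [CharZero k] (l : Label W) (h : l.Defined n)
    (hl : l ≠ emptyLabel W) (hD : ∀ hW : W = .D, l ≠ hW ▸ negRow n)
    {x : spechtIdeal k W.cover (l.paddedTableau h)} (hx : x ∈ (stableRep k l h).invariants) :
    x = 0 := by
  apply Subtype.ext
  apply eq_zero_of_charMap_eq_zero ((invariant_iff l h x).1 hx) (charMap_one_eq_zero l h hl x.2)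
  rintro rfl
  exact charMap_signProd_eq_zero l h (hD rfl) x.2

theorem stableRep_emptyLabel_invariant_eq_zero [CharZero k]
    {x : spechtIdeal k W.cover ((emptyLabel W).paddedTableau (emptyLabel_defined W n))}
    (hx : x ∈ (stableRep k (emptyLabel W) (emptyLabel_defined W n)).invariants)
    (h1 : charMap k 1 x.1 = 0) : x = 0 := by
  apply Subtype.ext
  apply eq_zero_of_charMap_eq_zero ((invariant_iff _ _ x).1 hx) h1
  rintro rfl
  -- For `n = 0` the empty label coincides with `(∅, (n))`, but the two characters coincide as well.
  rcases Nat.eq_zero_or_pos n with rfl | hn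
  · have : signProd WeylType.D.cover 0 = 1 := by
      ext w
      simp [signProd]
    rw [this, h1]
  · apply charMap_signProd_eq_zero _ _ _ x.2
    intro h
    have h2 := congrArg (fun l : Label .D => l.neg.card) h
    simp only [negRow, card_addRow, emptyLabel, card_bot] at h2
    omega

/-- The sum of all group elements times the symmetrizer is a scalar multiple of that sum. The scalar
is the order of the row group, since in a one-row diagram the column sum is `1`. -/
theorem exists_mem_spechtIdeal_invariant [CharZero k] {μ : YoungDiagram} (T : Fin n ≃ Cells μ ⊥)
    (hμ : ∀ c ∈ μ, c.1 = 0) : ∃ x ∈ spechtIdeal k W T,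
      (∀ g, MonoidAlgebra.of k _ g * x = x) ∧ charMap k 1 x ≠ 0 := by
  classical
  have hcol : charMap k 1 (colSum k W T) = 1 := by
    apply charMap_colSum_eq_one _ _ fun _ => rfl
    rintro (⟨c, hc⟩ | ⟨c, hc⟩) (⟨c', hc'⟩ | ⟨c', hc'⟩) h
    · have h1 : c.2 = c'.2 := by simpa [colOf] using h
      have h2 : c = c' := Prod.ext ((hμ c hc).trans (hμ c' hc').symm) h1
      subst h2
      rfl
    · simp at hc'
    · simp at hc
    · simp at hc
  have hmul := sum_of_mul (rowSum k W T * colSum k W T)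
  rw [map_mul, hcol, mul_one] at hmul
  refine ⟨charMap k 1 (rowSum k W T) • ∑ g, MonoidAlgebra.of k _ g, ⟨_, hmul⟩, fun g => ?_, ?_⟩
  · rw [mul_smul_comm, Finset.mul_sum]
    congr 1
    simp only [← map_mul]
    exact (Group.mulLeft_bijective _).sum_comp fun h => MonoidAlgebra.of k _ h
  · rw [map_smul, smul_eq_mul]
    refine mul_ne_zero (charMap_one_rowSum_ne_zero T) ?_
    simp only [map_sum, charMap_of, MonoidHom.one_apply, Units.val_one, Int.cast_one,
      Finset.sum_const, Finset.card_univ, nsmul_eq_mul, mul_one]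
    exact Nat.cast_ne_zero.2 Fintype.card_ne_zero

theorem exists_stableRep_emptyLabel_invariant [CharZero k] (n : ℕ) :
    ∃ x ∈ (stableRep k (emptyLabel W) (emptyLabel_defined W n)).invariants,
      charMap k 1 x.1 ≠ 0 := by
  obtain ⟨x, hx, hinv, h1⟩ := exists_mem_spechtIdeal_invariant (k := k) (W := W.cover)
    ((emptyLabel W).paddedTableau (emptyLabel_defined W n)) (by
      rintro ⟨a, b⟩ hab
      rcases mem_addRow.1 hab with ⟨rfl, -⟩ | ⟨i, -, hi⟩
      · rfl
      · exact absurd hi (YoungDiagram.notMem_bot _))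
  exact ⟨⟨x, hx⟩, (invariant_iff _ _ _).2 fun w => hinv _, h1⟩

end Invariants

/-! ## Decompositions and invariants -/

section DirectSum

variable {k G ι : Type*} [Field k] [Group G] {V : ι → Type*} [∀ i, AddCommGroup (V i)]
  [∀ i, Module k (V i)] (ρ : ∀ i, Representation k G (V i))

theorem directSum_apply (g : G) (x : DirectSum ι V) (i : ι) :
    Representation.directSum ρ g x i = ρ i g (x i) :=
  DirectSum.lmap_apply _ _ _

theorem directSum_lof [DecidableEq ι] (g : G) (i : ι) (y : V i) :
    Representation.directSum ρ g (DirectSum.lof k ι V i y) = DirectSum.lof k ι V i (ρ i g y) :=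
  DirectSum.lmap_lof _ _ _

theorem invariant_component {x : DirectSum ι V} (hx : x ∈ (Representation.directSum ρ).invariants)
    (i : ι) : x i ∈ (ρ i).invariants := by
  rw [Representation.mem_invariants] at hx ⊢
  intro g
  rw [← directSum_apply, hx]

variable {U : Type*} [AddCommGroup U] [Module k U] {ρ} {τ : Representation k G U}
  (e : τ.Equiv (Representation.directSum ρ)) {J : Type*} (ix : J → ι) (θ : ∀ j, V (ix j) →ₗ[k] k)

/-- Linear functionals on some of the summands of a representation, as coordinates of its invariant
vectors. -/
noncomputable def invariantCoord : τ.invariants →ₗ[k] (J → k) :=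
  LinearMap.pi fun j => θ j ∘ₗ DirectSum.component k ι V (ix j) ∘ₗ
    e.toLinearEquiv.toLinearMap ∘ₗ τ.invariants.subtype

theorem invariantCoord_apply (x : τ.invariants) (j : J) :
    invariantCoord e ix θ x j = θ j (e x.1 (ix j)) := rfl

theorem equiv_mem_invariants {x : U} (hx : x ∈ τ.invariants) :
    e x ∈ (Representation.directSum ρ).invariants := by
  rw [Representation.mem_invariants] at hx ⊢
  intro g
  have h := e.toIntertwiningMap.isIntertwining _ _ g x
  rw [hx] at h
  exact h.symm

theorem equiv_symm_apply_apply (g : G) (z : DirectSum ι V) :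
    e.symm (Representation.directSum ρ g z) = τ g (e.symm z) :=
  e.symm.toIntertwiningMap.isIntertwining _ _ g z

theorem invariantCoord_injective (h : ∀ i ∉ Set.range ix, ∀ y ∈ (ρ i).invariants, y = 0)
    (hθ : ∀ j, ∀ y ∈ (ρ (ix j)).invariants, θ j y = 0 → y = 0) :
    Function.Injective (invariantCoord e ix θ) := by
  rw [← LinearMap.ker_eq_bot, LinearMap.ker_eq_bot']
  intro x hx
  have hinv := equiv_mem_invariants e x.2
  have h0 : e x.1 = 0 := by
    refine DFinsupp.ext fun i => ?_
    have hi := invariant_component _ hinv i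
    by_cases hr : i ∈ Set.range ix
    · obtain ⟨j, rfl⟩ := hr
      exact hθ j _ hi (congrFun hx j)
    · exact h i hr _ hi
  apply Subtype.ext
  apply e.toLinearEquiv.injective
  rw [Submodule.coe_zero, map_zero]
  exact h0

theorem invariantCoord_surjective [Fintype J] (hix : Function.Injective ix)
    (hθ : ∀ j, ∃ y ∈ (ρ (ix j)).invariants, θ j y ≠ 0) :
    Function.Surjective (invariantCoord e ix θ) := by
  classical
  choose s hs hs1 using hθ
  intro a
  let z : DirectSum ι V := ∑ j, (a j * (θ j (s j))⁻¹) • DirectSum.lof k ι V (ix j) (s j)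
  have hz : ∀ g, Representation.directSum ρ g z = z := by
    intro g
    rw [map_sum]
    refine Finset.sum_congr rfl fun j _ => ?_
    rw [map_smul, directSum_lof, (Representation.mem_invariants _ _).1 (hs j)]
  have hx : e.symm z ∈ τ.invariants := by
    rw [Representation.mem_invariants]
    intro g
    rw [← equiv_symm_apply_apply, hz]
  refine ⟨⟨_, hx⟩, funext fun j => ?_⟩
  rw [invariantCoord_apply, Representation.Equiv.apply_symm_apply]
  have hzj : z (ix j) = (a j * (θ j (s j))⁻¹) • s j := by
    rw [DirectSum.apply_eq_component k z (ix j), map_sum, Finset.sum_eq_single j]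
    · rw [map_smul, DirectSum.component.lof_self]
    · intro j' _ hj
      rw [map_smul, DirectSum.component.of, dif_neg (hix.ne hj), smul_zero]
    · simp
  rw [hzj, map_smul, smul_eq_mul, inv_mul_cancel_right₀ (hs1 j)]

end DirectSum

/-! ### Bounding invariants by the multiplicity of the empty label. -/

section Decomposition

variable {k : Type u} [Field k] {W : WeylType}

theorem Decomposes.exists_injective [CharZero k] {V : FI W ⥤ ModuleCat.{v} k} {n : ℕ}
    {c : Label W → ℕ} (h : Decomposes V n c) (hD : ∀ hW : W = .D,
      (hW ▸ negRow n : Label W) ≠ emptyLabel W → c (hW ▸ negRow n) = 0) :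
    ∃ f : (rep V n).invariants →ₗ[k] (Fin (c (emptyLabel W)) → k), Function.Injective f := by
  obtain ⟨e⟩ := h
  refine ⟨invariantCoord e (fun j => ⟨⟨emptyLabel W, emptyLabel_defined W n⟩, j⟩)
    (fun j => (charMap k 1).toLinearMap ∘ₗ Submodule.subtype _), invariantCoord_injective _ _ _ ?_ ?_⟩
  · rintro ⟨⟨l, hl⟩, j⟩ hr y hy
    have hle : l ≠ emptyLabel W := by
      rintro rfl
      exact hr ⟨j, rfl⟩
    refine stableRep_invariant_eq_zero l hl hle (fun hW h => ?_) hy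
    have h1 := hD hW (h ▸ hle)
    rw [← h] at h1
    exact Fin.elim0 (Fin.cast h1 j)
  · intro j y hy h
    exact stableRep_emptyLabel_invariant_eq_zero hy h

theorem Decomposes.exists_surjective [CharZero k] {V : FI W ⥤ ModuleCat.{v} k} {n : ℕ}
    {c : Label W → ℕ} (h : Decomposes V n c) :
    ∃ f : (rep V n).invariants →ₗ[k] (Fin (c (emptyLabel W)) → k), Function.Surjective f := by
  obtain ⟨e⟩ := h
  refine ⟨invariantCoord e (fun j => ⟨⟨emptyLabel W, emptyLabel_defined W n⟩, j⟩)
    (fun j => (charMap k 1).toLinearMap ∘ₗ Submodule.subtype _), invariantCoord_surjective _ _ _ ?_ ?_⟩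
  · intro j j' h
    simpa using h
  · exact fun _ => exists_stableRep_emptyLabel_invariant n

/-- An upper bound at `n` and a lower bound at `n + 1` suffice, so an extra trivial summand `(∅,
(n+1))` at stage `n + 1` need not be excluded. -/
theorem stageMap_bijective_of_decomposes [CharZero k] {V : FI W ⥤ ModuleCat.{v} k} {n : ℕ}
    {c c' : Label W → ℕ} (h : Decomposes V n c) (h' : Decomposes V (n + 1) c')
    (hc : c (emptyLabel W) = c' (emptyLabel W))
    (hD : ∀ hW : W = .D, (hW ▸ negRow n : Label W) ≠ emptyLabel W → c (hW ▸ negRow n) = 0)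
    (hs : Function.Surjective (stageMap V n)) : Function.Bijective (stageMap V n) := by
  refine ⟨?_, hs⟩
  obtain ⟨f, hf⟩ := h.exists_injective hD
  obtain ⟨f', hf'⟩ := h'.exists_surjective
  have hg : Function.Surjective (f' ∘ₗ stageMap V n) := hf'.comp hs
  have : Module.Finite k (rep V n).invariants := Module.Finite.of_injective _ hf
  have h1 := LinearMap.finrank_le_finrank_of_injective hf
  have h2 := LinearMap.finrank_le_finrank_of_surjective hg
  rw [Module.finrank_fin_fun] at h1 h2
  have h3 := (LinearMap.injective_iff_surjective_of_finrank_eq_finrank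
    (by rw [Module.finrank_fin_fun]; omega)).2 hg
  exact Function.Injective.of_comp h3

end Decomposition

/-! ## Sign characters in type D -/

section TypeD

/-- The product of a family of signs. -/
def prodHom (n : ℕ) : (Fin n → ℤˣ) →* ℤˣ where
  toFun s := ∏ i, s i
  map_one' := by simp
  map_mul' s t := Finset.prod_mul_distrib

/-- The even sign changes, as elements of `D_n`. -/
def evenSignChange (n : ℕ) : (prodHom n).ker →* weylGroup .D n where
  toFun s := signChange .D s.1 (fun h => nomatch h) fun _ => s.2
  map_one' := by
    apply Subtype.ext
    apply Equiv.ext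
    intro t
    simp [signChange_apply]
  map_mul' s t := by
    apply Subtype.ext
    apply Equiv.ext
    intro u
    refine Prod.ext rfl ?_
    change u.2 * (s.1 u.1 * t.1 u.1) = u.2 * t.1 u.1 * s.1 u.1
    rw [mul_comm (s.1 u.1), mul_assoc]

variable {k : Type u} [Field k] [CharZero k]

/-- A vector on which the even sign changes act by the product of the signs at a set `I` vanishes, if
`I` and its complement have more than `d` elements and the module is generated in stage `d`. -/
theorem eq_zero_of_rep_evenSignChange {V : FI .D ⥤ ModuleCat.{v} k} {d n : ℕ}
    (hV : GeneratedInStage V d) (hn : d ≤ n) (I : Finset (Fin n)) (hI : d < I.card)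
    (hI' : d < Iᶜ.card) {x : V.obj ⟨n⟩}
    (hx : ∀ s, rep V n (evenSignChange n s) x = ((∏ i ∈ I, s.1 i : ℤˣ) : ℤ) • x) : x = 0 := by
  classical
  set T := (prodHom n).ker with hT
  have := Fintype.ofFinite T
  let χ : T → ℤ := fun s => ((∏ i ∈ I, s.1 i : ℤˣ) : ℤ)
  have hχ : ∀ s t, χ (s * t) = χ s * χ t := fun s t => by
    simp [χ, Finset.prod_mul_distrib]
  have hχ2 : ∀ s, χ s * χ s = 1 := fun s => by
    simp only [χ, ← Units.val_mul, Int.units_mul_self, Units.val_one]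
  -- The unnormalized projector to the `χ`-eigenspace: it multiplies `x` by the order of `T`, and it
  -- will vanish on all generators.
  let P : V.obj ⟨n⟩ →ₗ[k] V.obj ⟨n⟩ := ∑ s : T, χ s • rep V n (evenSignChange n s)
  have hP : ∀ y, P y = ∑ s : T, χ s • rep V n (evenSignChange n s) y := fun y => by
    simp [P, LinearMap.sum_apply]
  have hPx : P x = (Fintype.card T : k) • x := by
    rw [hP, Finset.sum_congr rfl fun s _ => by rw [hx s, smul_smul, hχ2 s, one_smul]]
    rw [Finset.sum_const, Finset.card_univ, Nat.cast_smul_eq_nsmul]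
  have hP0 : ∀ y, P y = 0 := by
    intro y
    have hy : y ∈ Submodule.span k (⋃ f : (⟨d⟩ : FI .D) ⟶ ⟨n⟩,
        Set.range fun x : V.obj ⟨d⟩ => (V.map f).hom x) := by
      rw [hV n hn]; trivial
    induction hy using Submodule.span_induction with
    | zero => exact map_zero P
    | add a b _ _ ha hb => rw [map_add, ha, hb, add_zero]
    | smul r a _ ha => rw [map_smul, ha, smul_zero]
    | mem y hy =>
      obtain ⟨f, y, rfl⟩ := Set.mem_iUnion.1 hy
      let J : Finset (Fin n) := Finset.univ.image fun i => (f.1 (i, 1)).1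
      -- The morphism reaches at most `d` absolute values, so it misses a point in `I` and one
      -- outside it. Two points are needed to keep the sign change even.
      have hJ : J.card ≤ d := Finset.card_image_le.trans_eq (by simp)
      obtain ⟨i, hi, hiJ⟩ := Finset.exists_mem_notMem_of_card_lt_card (hJ.trans_lt hI)
      obtain ⟨j, hj, hjJ⟩ := Finset.exists_mem_notMem_of_card_lt_card (hJ.trans_lt hI')
      have hjI : j ∉ I := Finset.mem_compl.1 hj
      let t₀ : Fin n → ℤˣ := Pi.mulSingle i (-1) * Pi.mulSingle j (-1)
      have ht₀ : t₀ ∈ T := by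
        change ∏ l, t₀ l = 1
        simp [t₀, Finset.prod_mul_distrib]
      let t : T := ⟨t₀, ht₀⟩
      have hχt : χ t = -1 := by
        simp only [χ, t, t₀, Pi.mul_apply, Finset.prod_mul_distrib, Finset.prod_pi_mulSingle',
          if_pos hi, if_neg hjI]
        rfl
      have hft : f ≫ weylHom (evenSignChange n t) = f := by
        apply Subtype.ext
        funext u
        have hu : (f.1 u).1 ∈ J := Finset.mem_image.2
          ⟨u.1, Finset.mem_univ _, by rw [apply_eq_of_map_flip f.2.map_flip u]⟩
        refine Prod.ext rfl ?_
        change (f.1 u).2 * ((Pi.mulSingle i (-1) : Fin n → ℤˣ) (f.1 u).1 *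
          (Pi.mulSingle j (-1) : Fin n → ℤˣ) (f.1 u).1) = _
        rw [Pi.mulSingle_eq_of_ne (show (f.1 u).1 ≠ i from fun h => hiJ (h ▸ hu)),
          Pi.mulSingle_eq_of_ne (show (f.1 u).1 ≠ j from fun h => hjJ (h ▸ hu)), mul_one, mul_one]
      have hfix : rep V n (evenSignChange n t) ((V.map f).hom y) = (V.map f).hom y := by
        rw [rep_apply, ← map_comp_apply, hft]
      have hneg : P ((V.map f).hom y) = -P ((V.map f).hom y) := by
        conv_lhs => rw [hP, ← (Group.mulRight_bijective t).sum_comp]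
        rw [hP, ← Finset.sum_neg_distrib]
        refine Finset.sum_congr rfl fun s _ => ?_
        rw [hχ, hχt, map_mul, map_mul, Module.End.mul_apply, hfix]
        simp
      have h2 : (2 : k) • P ((V.map f).hom y) = 0 := by
        rw [two_smul]
        nth_rewrite 2 [hneg]
        exact add_neg_cancel _
      exact (smul_eq_zero.1 h2).resolve_left two_ne_zero
  rw [hP0] at hPx
  exact (smul_eq_zero.1 hPx.symm).resolve_left (Nat.cast_ne_zero.2 Fintype.card_ne_zero)

theorem card_filter_isRight {n : ℕ} {μ ν : YoungDiagram} (T : Fin n ≃ Cells μ ν) :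
    (Finset.univ.filter fun i => (T i).isRight).card = ν.card := by
  rw [Finset.card_filter, T.sum_comp fun a => if a.isRight then 1 else 0, Fintype.sum_sum_type]
  simp [YoungDiagram.card]

theorem negRow_size (n : ℕ) : (negRow n).size = n := by
  simp [Label.size, negRow, card_addRow, card_bot]

theorem negRow_defined {m n : ℕ} (h : m ≤ n) : (negRow m).Defined n := by
  rw [Label.Defined, negRow_size, negRow, rowLen_bot]
  exact h

/-- The Young symmetrizer of `((n - m), (m))` is a nonzero vector on which sign changes act through
the `m` entries of the second diagram; the other `n - m` entries number more than `d` as well. -/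
theorem Decomposes.negRow_eq_zero {V : FI .D ⥤ ModuleCat.{v} k} {d m n : ℕ}
    (hV : GeneratedInStage V d) (hm : d < m) (hn : m + d < n) {c : Label .D → ℕ}
    (h : Decomposes V n c) : c (negRow m) = 0 := by
  classical
  by_contra hc
  obtain ⟨e⟩ := h
  have hdef : (negRow m).Defined n := negRow_defined (by omega)
  set T := (negRow m).paddedTableau hdef with hT
  let ix : Σ l : {l : Label .D // l.Defined n}, Fin (c l.1) :=
    ⟨⟨negRow m, hdef⟩, ⟨0, Nat.pos_of_ne_zero hc⟩⟩
  let y : spechtIdeal k WeylType.D.cover T :=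
    ⟨rowSum k _ T * colSum k _ T, 1, one_mul _⟩
  have hy0 : y ≠ 0 := fun h => rowSum_mul_colSum_ne_zero T (congrArg Subtype.val h)
  let z := DirectSum.lof k _ (fun x : (Σ l : {l : Label .D // l.Defined n}, Fin (c l.1)) =>
    spechtIdeal k WeylType.D.cover (x.1.1.paddedTableau x.1.2)) ix y
  have hz0 : z ≠ 0 := fun h => hy0 (by
    have h1 := congrArg (DirectSum.component k _ _ ix) h
    rw [DirectSum.component.lof_self, map_zero] at h1
    exact h1)
  let I : Finset (Fin n) := Finset.univ.filter fun i => (T i).isRight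
  have hI : I.card = m := by
    rw [card_filter_isRight]
    simp [negRow, card_addRow, card_bot]
  have hact : ∀ s, rep V n (evenSignChange n s) (e.symm z) =
      ((∏ i ∈ I, s.1 i : ℤˣ) : ℤ) • e.symm z := by
    intro s
    rw [← equiv_symm_apply_apply, directSum_lof]
    have h1 : stableRep k (negRow m) hdef (evenSignChange n s) y =
        (((∏ i ∈ I, s.1 i : ℤˣ) : ℤ) : k) • y := by
      apply Subtype.ext
      refine (coe_specht_apply _ _ _).trans ?_
      change MonoidAlgebra.of k _ (signChange .BC s.1 (fun h => nomatch h) fun h => nomatch h) *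
        (rowSum k .BC T * colSum k .BC T) = _
      rw [← mul_assoc, of_signChange_mul_rowSum, smul_mul_assoc]
      rfl
    refine (congrArg (fun w => e.symm (DirectSum.lof k _ _ ix w)) h1).trans ?_
    rw [map_smul, map_smul, Int.cast_smul_eq_zsmul]
  have h0 := eq_zero_of_rep_evenSignChange hV (by omega) I (by omega)
    (by rw [Finset.card_compl, hI, Fintype.card_fin]; omega) hact
  apply hz0
  rw [← e.apply_symm_apply z, h0, map_zero]

end TypeD

/-! ### The stable range and the type D exception. -/

theorem HasStableRange.stageMap_bijective {W : WeylType} {k : Type u} [Field k] [CharZero k]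
    {V : FI W ⥤ ModuleCat.{v} k} {d N : ℕ} {c : Label W → ℕ → ℕ} (hV : GeneratedInStage V d)
    (h : HasStableRange V N c) {n : ℕ} (hN : N ≤ n) (hd : d ≤ n) (hE : ¬ Exceptional W c n d) :
    Function.Bijective (stageMap V n) := by
  have hD : ∀ hW : W = .D, (hW ▸ negRow n : Label W) ≠ emptyLabel W →
      c (hW ▸ negRow n) n = 0 := by
    rintro rfl hne
    rcases hd.lt_or_eq with hlt | rfl
    -- At stage `n` itself the complement of the second diagram is empty. Constancy of the
    -- multiplicity moves the label to a stage where both parts have more than `d` entries.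
    · have h1 := h.constant (negRow n) n (2 * n + 1) hN (by omega) (negRow_defined le_rfl)
        (negRow_defined (by omega))
      exact h1.trans ((h.decomposes (2 * n + 1) (by omega)).negRow_eq_zero hV hlt (by omega))
    · by_contra hc
      refine hE ⟨rfl, Nat.one_le_iff_ne_zero.2 ?_, hc⟩
      -- For `n = d = 0` there is no exception: `(∅, (0))` is the empty label.
      rintro rfl
      apply hne
      have : (negRow 0).neg = ⊥ := by
        apply diagram_ext
        rw [YoungDiagram.cells_bot, ← Finset.card_eq_zero]
        exact (card_addRow 0 ⊥ (rowLen_bot 0).le).trans (by rw [card_bot])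
      change (⟨⊥, (negRow 0).neg, _⟩ : Label .D) = ⟨⊥, ⊥, _⟩
      simp only [this]
  exact stageMap_bijective_of_decomposes (h.decomposes n hN) (h.decomposes (n + 1) (by omega))
    (h.constant _ _ _ hN (by omega) (emptyLabel_defined _ _) (emptyLabel_defined _ _)) hD
    (stageMap_surjective hV hd)

end FIW

theorem mainTheorem5 :
    -- equivariant maps between representations of finite groups over `ℚ`
    (∀ (H₁ H₂ V₁ V₂ : Type*) [Group H₁] [Group H₂] [Finite H₁] [Finite H₂]
      [AddCommGroup V₁] [AddCommGroup V₂] [Module ℚ V₁] [Module ℚ V₂]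
      (ρ₁ : Representation ℚ H₁ V₁) (ρ₂ : Representation ℚ H₂ V₂)
      (j : H₁ →* H₂) (φ : V₁ →ₗ[ℚ] V₂),
      (∀ h v, φ (ρ₁ h v) = ρ₂ (j h) (φ v)) →
      Submodule.span ℚ {y | ∃ (h : H₂) (v : V₁), y = ρ₂ h (φ v)} = ⊤ →
      Function.Surjective (FIW.averagedMap ρ₁ ρ₂ φ)) ∧
    -- finitely generated `FI_W`-modules
    (∀ (W : FIW.WeylType) (k : Type*) [Field k] [CharZero k] (V : FIW.FI W ⥤ ModuleCat k) (d : ℕ),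
      FIW.FinitelyGenerated V → FIW.GeneratedInStage V d →
      (∀ n, d ≤ n → Function.Surjective (FIW.stageMap V n)) ∧
      (∀ (N : ℕ) (c : FIW.Label W → ℕ → ℕ), FIW.HasStableRange V N c →
        ∀ n, N ≤ n → d ≤ n → ¬ FIW.Exceptional W c n d →
          Function.Bijective (FIW.stageMap V n))) ∧
    -- finitely generated `FI_W#`-modules
    (∀ (W : FIW.SharpType) (k : Type*) [Field k] [CharZero k]
      (V : FIW.FISharp W ⥤ ModuleCat k) (d : ℕ),
      FIW.FinitelyGenerated (FIW.underlying V) → FIW.GeneratedInStage (FIW.underlying V) d →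
      ∀ n, d ≤ n → Function.Bijective (FIW.stageMap (FIW.underlying V) n)) := by
  refine ⟨?_, ?_, ?_⟩
  · intro H₁ H₂ V₁ V₂ _ _ _ _ _ _ _ _ ρ₁ ρ₂ j φ hφ hspan
    exact FIW.averagedMap_surjective ρ₁ ρ₂ φ (fun h => ⟨j h, hφ h⟩) hspan
  · intro W k _ _ V d _ hV
    exact ⟨fun n hn => FIW.stageMap_surjective hV hn,
      fun N c h n hN hd hE => h.stageMap_bijective hV hN hd hE⟩
  · intro W k _ _ V d _ hV n hn
    exact ⟨FIW.stageMap_underlying_injective V n, FIW.stageMap_surjective hV hn⟩
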